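/- Let $n\ge 1$ and $1<\alpha<2$, and let $\Omega\subset\mathbb R^n$ be a domain (a non-empty connected open set) with non-empty boundary. Put $$\kappa_{n,\alpha}=\pi^{\frac{n-1}{2}}\,\frac{\Gamma(\frac{1+\alpha}{2})}{\Gamma(\frac{n+\alpha}{2})}\,\frac1\alpha\left[\frac{2^{1-\alpha}}{\sqrt\pi}\,\Gamma\!\left(\tfrac{2-\alpha}{2}\right)\Gamma\!\left(\tfrac{1+\alpha}{2}\right)-1\right].$$ For $x\in\Omega$ and a unit vector $w$ let $$d_{w,\Omega}(x)=\min\{|t|: x+tw\notin\Omega\},\qquad \delta_{w,\Omega}(x)=\sup\{|t|: x+tw\in\Omega\},$$ both with values in $(0,\infty]$ (where $\min\emptyset=\infty$ and $1/\infty=0$), and $$\frac1{M_\alpha(x)^\alpha}:=\frac{\int_{\mathbb S^{n-1}}\left[\frac1{d_{w,\Omega}(x)}+\frac1{\delta_{w,\Omega}(x)}\right]^\alpha dw}{\int_{\mathbb S^{n-1}}|w_n|^\alpha\,dw},$$ where $dw$ is surface measure on the unit sphere (counting measure on $\{\pm1\}$ if $n=1$). Then for every real- or complex-valued $f\in C_c^\infty(\Omega)$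 $$\frac12\int_{\Omega\times\Omega}\frac{|f(x)-f(y)|^2}{|x-y|^{n+\alpha}}\,dx\,dy\;\ge\;\kappa_{n,\alpha}\int_\Omega\frac{|f(x)|^2}{M_\alpha(x)^\alpha}\,dx. \tag{1}$$ Suppose in addition that $\Omega$ is convex. Let $d_\Omega(x)$ be the distance from $x\in\Omega$ to $\partial\Omega$. For a supporting hyperplane $P$ of $\Omega$ let $D_{S(P)}\in(0,\infty]$ be the width of the smallest slab that contains $\Omega$ and is bounded by $P$ on one side and by a hyperplane parallel to $P$ on the other ($D_{S(P)}=\infty$ if this slab is a half-space), and let $D_\Omega(x)$ be the infimum of $D_{S(P)}$ over all supporting hyperplanes $P$ of $\Omega$ that pass through a point $z\in\partial\Omega$ with $|x-z|=d_\Omega(x)$. Then for every $f\in C_c^\infty(\Omega)$ $$\frac12\int_{\Omega\times\Omega}\frac{|f(x)-f(y)|^2}{|x-y|^{n+\alpha}}\,dx\,dy\;\ge\;\kappa_{n,\alpha}\int_\Omega|f(x)|^2\left[\frac1{d_\Omega(x)}+\frac1{D_\Omega(x)-d_\Omega(x)}\right]^\alpha dx \tag{2}$$ and in particular $$\frac12\int_{\Omega\times\Omega}\frac{|f(x)-f(y)|^2}{|x-y|^{n+\alpha}}\,dx\,dy\;\ge\;\kappa_{n,\alpha}\int_\Omega\frac{|f(x)|^2}{d_\Omega(x)^\alpha}\,dx.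 \tag{3}$$ For every such convex $\Omega$ the constant $\kappa_{n,\alpha}$ is best possible in each of (1), (2) and (3): if one of these inequalities holds for all $f\in C_c^\infty(\Omega)$ with a real number $C$ in place of $\kappa_{n,\alpha}$, then $C\le\kappa_{n,\alpha}$. This sharpness already holds when only real-valued $f$ are considered. -/

import Mathlib

open MeasureTheory Set Metric
open scoped ENNReal NNReal ContDiff

noncomputable section

namespace FracHardy

/-- Euclidean space `ℝⁿ`. -/
abbrev E (n : ℕ) : Type := EuclideanSpace ℝ (Fin n)

/-- The constant `κ_{n,α}`. -/
def kappa (n : ℕ) (α : ℝ) : ℝ :=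
  Real.pi ^ (((n : ℝ) - 1) / 2) * (Real.Gamma ((1 + α) / 2) / Real.Gamma (((n : ℝ) + α) / 2))
    * (1 / α)
    * ((2 : ℝ) ^ (1 - α) / Real.sqrt Real.pi * Real.Gamma ((2 - α) / 2) * Real.Gamma ((1 + α) / 2)
        - 1)

/-- `d_{w,Ω}(x) = min {|t| : x + t w ∉ Ω}`, equal to `∞` if the whole line lies in `Ω`. -/
def dirDist {n : ℕ} (Ω : Set (E n)) (w x : E n) : ℝ≥0∞ :=
  ⨅ (t : ℝ) (_ : x + t • w ∉ Ω), ENNReal.ofReal |t|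

/-- `δ_{w,Ω}(x) = sup {|t| : x + t w ∈ Ω}`, possibly `∞`. -/
def dirDelta {n : ℕ} (Ω : Set (E n)) (w x : E n) : ℝ≥0∞ :=
  ⨆ (t : ℝ) (_ : x + t • w ∈ Ω), ENNReal.ofReal |t|

/-- The weight `1 / M_α(x)^α`: the average over the unit sphere, with its surface measure, of
`(1 / d_{w,Ω}(x) + 1 / δ_{w,Ω}(x))^α`, normalised by the integral of `|w_n|^α`, where `w_n` is the
last coordinate of `w`. Here `1 / ∞ = 0`. -/
def weightM {n : ℕ} [NeZero n] (α : ℝ) (Ω : Set (E n)) (x : E n) : ℝ≥0∞ :=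
  (∫⁻ w : sphere (0 : E n) 1,
      ((dirDist Ω (w : E n) x)⁻¹ + (dirDelta Ω (w : E n) x)⁻¹) ^ α
        ∂(volume : Measure (E n)).toSphere) /
  (∫⁻ w : sphere (0 : E n) 1,
      ENNReal.ofReal |(w : E n) ⟨n - 1, Nat.sub_one_lt (NeZero.ne n)⟩| ^ α
        ∂(volume : Measure (E n)).toSphere)

/-- `d_Ω(x)`: the distance from `x` to the boundary of `Ω`. -/
def bdryDist {n : ℕ} (Ω : Set (E n)) (x : E n) : ℝ≥0∞ :=
  infEDist x (frontier Ω)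

/-- The points of the boundary of `Ω` that are closest to `x`. -/
def closestBdryPoints {n : ℕ} (Ω : Set (E n)) (x : E n) : Set (E n) :=
  {z | z ∈ frontier Ω ∧ edist x z = bdryDist Ω x}

/-- The supporting hyperplanes `{y : ⟪ν, y - z⟫ = 0}` of `Ω` through `z`, each given by its unit
normal `ν` that points to the side on which `Ω` lies. -/
def supportingNormals {n : ℕ} (Ω : Set (E n)) (z : E n) : Set (E n) :=
  {ν | ‖ν‖ = 1 ∧ ∀ y ∈ Ω, 0 ≤ inner ℝ ν (y - z)}

/-- The slab of width `D` bounded on one side by the hyperplane through `z` with unit normal `ν`,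
and lying on the side of `ν`; it is a half-space if `D = ∞`. -/
def slab {n : ℕ} (z ν : E n) (D : ℝ≥0∞) : Set (E n) :=
  {y | 0 ≤ inner ℝ ν (y - z) ∧ ENNReal.ofReal (inner ℝ ν (y - z)) ≤ D}

/-- The width of the smallest slab that contains `Ω` and is bounded on one side by the supporting
hyperplane through `z` with unit normal `ν`. -/
def slabWidth {n : ℕ} (Ω : Set (E n)) (z ν : E n) : ℝ≥0∞ :=
  sInf {D : ℝ≥0∞ | Ω ⊆ slab z ν D}

/-- The width `D_Ω(x)` of `Ω` with respect to `x`. -/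
def widthAt {n : ℕ} (Ω : Set (E n)) (x : E n) : ℝ≥0∞ :=
  ⨅ (z ∈ closestBdryPoints Ω x) (ν ∈ supportingNormals Ω z), slabWidth Ω z ν

/-- The weight `(1 / d_Ω(x) + 1 / (D_Ω(x) - d_Ω(x)))^α`; here `∞ - d = ∞` and `1 / ∞ = 0`. -/
def weightD {n : ℕ} (α : ℝ) (Ω : Set (E n)) (x : E n) : ℝ≥0∞ :=
  ((bdryDist Ω x)⁻¹ + (widthAt Ω x - bdryDist Ω x)⁻¹) ^ α

/-- The weight `1 / d_Ω(x)^α`. -/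
def weightd {n : ℕ} (α : ℝ) (Ω : Set (E n)) (x : E n) : ℝ≥0∞ :=
  (bdryDist Ω x ^ α)⁻¹

/-- `f ∈ C_c^∞(Ω)`. -/
def IsTestFun {𝕜 : Type*} [RCLike 𝕜] {n : ℕ} (Ω : Set (E n)) (f : E n → 𝕜) : Prop :=
  ContDiff ℝ ∞ f ∧ HasCompactSupport f ∧ tsupport f ⊆ Ω

/-- The double integral of `|f(x) - f(y)|² / |x - y|^{n+α}` over `Ω × Ω`. -/
def gagliardo {𝕜 : Type*} [RCLike 𝕜] {n : ℕ} (α : ℝ) (Ω : Set (E n)) (f : E n → 𝕜) : ℝ≥0∞ :=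
  ∫⁻ p in Ω ×ˢ Ω, ‖f p.1 - f p.2‖ₑ ^ 2 / ‖p.1 - p.2‖ₑ ^ ((n : ℝ) + α)
    ∂((volume : Measure (E n)).prod (volume : Measure (E n)))

/-- The Hardy inequality on `Ω` with weight `W` and constant `C`, for all `𝕜`-valued functions in
`C_c^∞(Ω)`. -/
def HardyInequality (𝕜 : Type*) [RCLike 𝕜] {n : ℕ} (α : ℝ) (Ω : Set (E n)) (W : E n → ℝ≥0∞)
    (C : ℝ) : Prop :=
  ∀ f : E n → 𝕜, IsTestFun Ω f →
    ENNReal.ofReal C * ∫⁻ x in Ω, ‖f x‖ₑ ^ 2 * W x ≤ (1 / 2) * gagliardo α Ω f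

end FracHardy

end

noncomputable section

namespace FracHardy

open Filter Topology


/-- The kernel `|x - y| ^ (-(1 + α))` in logarithmic coordinates. -/
def logKernel (α r : ℝ) : ℝ := (2 * Real.sinh (r / 2)) ^ (-(1 + α))

theorem integral_beta {u v : ℝ} (hu : 0 < u) (hv : 0 < v) :
    IntervalIntegrable (fun y : ℝ ↦ y ^ (u - 1) * (1 - y) ^ (v - 1)) volume 0 1 ∧
      ∫ y in (0 : ℝ)..1, y ^ (u - 1) * (1 - y) ^ (v - 1) =
        Real.Gamma u * Real.Gamma v / Real.Gamma (u + v) := by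
  have hc := Complex.betaIntegral_convergent (u := u) (v := v) (by simpa) (by simpa)
  rw [intervalIntegrable_iff_integrableOn_Ioc_of_le zero_le_one] at hc
  have heq : ∀ y ∈ Ioc (0 : ℝ) 1,
      ((y : ℂ) ^ ((u : ℂ) - 1) * (1 - (y : ℂ)) ^ ((v : ℂ) - 1)).re =
        y ^ (u - 1) * (1 - y) ^ (v - 1) := by
    rintro y ⟨hy0, hy1⟩
    norm_cast
    rw [← Complex.ofReal_cpow hy0.le, ← Complex.ofReal_cpow (by linarith)]
    norm_cast
  constructor
  · rw [intervalIntegrable_iff_integrableOn_Ioc_of_le zero_le_one]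
    exact Integrable.congr hc.re ((ae_restrict_iff' measurableSet_Ioc).2 (ae_of_all _ heq))
  · have h := ProbabilityTheory.beta_eq_betaIntegralReal u v hu hv
    rw [ProbabilityTheory.beta] at h
    rw [h, Complex.betaIntegral, intervalIntegral.integral_of_le zero_le_one,
      intervalIntegral.integral_of_le zero_le_one]
    refine Eq.trans ?_ (integral_re hc)
    exact setIntegral_congr_fun measurableSet_Ioc fun y hy ↦ (heq y hy).symm

section Constant

variable {α : ℝ}

theorem hasDerivAt_primitive {p y : ℝ} (h0 : 0 < y) (h1 : y < 1) (hα : 1 + 2 * p ≠ 0) :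
    HasDerivAt (fun y : ℝ ↦ (1 - y ^ p) ^ 2 * (1 - y) ^ (-(1 + 2 * p)) / (1 + 2 * p) +
        1 / (1 + 2 * p) * ((y ^ p - y ^ (2 * p)) * (1 - y) ^ (-(2 * p))))
      ((1 - y ^ p) ^ 2 * (1 - y) ^ (-(2 + 2 * p)) -
        p / (1 + 2 * p) * (y ^ (p - 1) * (1 - y) ^ (-(2 * p)))) y := by
  have h1' : 0 < 1 - y := by linarith
  have hp : HasDerivAt (fun y : ℝ ↦ y ^ p) (p * y ^ (p - 1)) y :=
    Real.hasDerivAt_rpow_const (Or.inl h0.ne')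
  have hp2 : HasDerivAt (fun y : ℝ ↦ y ^ (2 * p)) (2 * p * y ^ (2 * p - 1)) y :=
    Real.hasDerivAt_rpow_const (Or.inl h0.ne')
  have hq (c : ℝ) : HasDerivAt (fun y : ℝ ↦ (1 - y) ^ c) (-1 * c * (1 - y) ^ (c - 1)) y :=
    ((hasDerivAt_id y).const_sub 1).rpow_const (Or.inl h1'.ne')
  have key := (((((hp.const_sub 1).pow 2).mul (hq (-(1 + 2 * p)))).div_const (1 + 2 * p)).add
    (((hp.sub hp2).mul (hq (-(2 * p)))).const_mul (1 / (1 + 2 * p))))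
  refine key.congr_deriv ?_
  have e1 : (1 - y) ^ (-(1 + 2 * p) - 1) = (1 - y) ^ (-(2 * p)) / (1 - y) ^ 2 := by
    rw [eq_div_iff (by positivity), ← Real.rpow_natCast, ← Real.rpow_add h1']
    congr 1; push_cast; ring
  have e2 : (1 - y) ^ (-(2 + 2 * p)) = (1 - y) ^ (-(2 * p)) / (1 - y) ^ 2 := by
    rw [← e1]; congr 1; ring
  have e3 : (1 - y) ^ (-(2 * p) - 1) = (1 - y) ^ (-(2 * p)) / (1 - y) := by
    rw [Real.rpow_sub_one h1'.ne']
  have e3' : (1 - y) ^ (-(1 + 2 * p)) = (1 - y) ^ (-(2 * p)) / (1 - y) := by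
    rw [← e3]; congr 1; ring
  have e4 : y ^ (p - 1) = y ^ p / y := Real.rpow_sub_one h0.ne' _
  have e5 : y ^ (2 * p) = y ^ p * y ^ p := by rw [← Real.rpow_add h0]; congr 1; ring
  have e6 : y ^ (2 * p - 1) = y ^ p * y ^ p / y := by rw [Real.rpow_sub_one h0.ne', e5]
  simp only [e1, e2, e3, e3', e4, e6, Pi.pow_apply, Pi.sub_apply, e5]
  set A := y ^ p
  set B := (1 - y) ^ (-(2 * p))
  have hα' : 1 + p * 2 ≠ 0 := by rwa [mul_comm p]
  simp only [Nat.cast_ofNat, Nat.add_one_sub_one, pow_one]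
  field_simp
  ring

theorem integrable_constant_integrand {p : ℝ} (hp0 : 0 < p) (hp1 : p < 1 / 2) :
    IntervalIntegrable (fun y : ℝ ↦ (1 - y ^ p) ^ 2 * (1 - y) ^ (-(2 + 2 * p))) volume 0 1 := by
  have h := (integral_beta (u := 1) (v := 1 - 2 * p) one_pos (by linarith)).1
  rw [intervalIntegrable_iff_integrableOn_Ioo_of_le zero_le_one] at h ⊢
  refine h.mono' (by fun_prop) ?_
  refine (ae_restrict_iff' measurableSet_Ioo).2 (ae_of_all _ ?_)
  rintro y ⟨h0, h1⟩
  have h1' : 0 < 1 - y := by linarith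
  have hy : y ≤ y ^ p := by
    conv_lhs => rw [← Real.rpow_one y]
    exact Real.rpow_le_rpow_of_exponent_ge h0 h1.le (by linarith)
  have hy1 : y ^ p ≤ 1 := Real.rpow_le_one h0.le h1.le hp0.le
  rw [Real.norm_of_nonneg (by positivity)]
  calc (1 - y ^ p) ^ 2 * (1 - y) ^ (-(2 + 2 * p))
      ≤ (1 - y) ^ 2 * (1 - y) ^ (-(2 + 2 * p)) := by gcongr
    _ = y ^ ((1 : ℝ) - 1) * (1 - y) ^ (1 - 2 * p - 1) := by
      rw [← Real.rpow_natCast, ← Real.rpow_add h1']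
      simp only [sub_self, Real.rpow_zero, one_mul]; congr 1; push_cast; ring

theorem integral_constant {p : ℝ} (hp0 : 0 < p) (hp1 : p < 1 / 2) :
    ∫ y in (0 : ℝ)..1, (1 - y ^ p) ^ 2 * (1 - y) ^ (-(2 + 2 * p)) =
      1 / (1 + 2 * p) *
        (Real.Gamma (p + 1) * Real.Gamma (1 - 2 * p) / Real.Gamma (1 - p) - 1) := by
  have hb := integral_beta (u := p) (v := 1 - 2 * p) hp0 (by linarith)
  have hi := integrable_constant_integrand hp0 hp1
  have e : ∀ y : ℝ, y ^ (p - 1) * (1 - y) ^ (-(2 * p)) =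
      y ^ (p - 1) * (1 - y) ^ (1 - 2 * p - 1) := fun y ↦ by
    congr 2; ring
  have hF := intervalIntegral.integral_eq_sub_of_hasDerivAt_of_tendsto
    (a := (0 : ℝ)) (b := 1) (fa := 1 / (1 + 2 * p)) (fb := 0) one_pos
    (fun y hy ↦ hasDerivAt_primitive (p := p) hy.1 hy.2 (by linarith))
    (hi.sub ((by simpa only [e] using hb.1 : IntervalIntegrable
      (fun y : ℝ ↦ y ^ (p - 1) * (1 - y) ^ (-(2 * p))) volume 0 1).const_mul _)) ?_ ?_
  · rw [intervalIntegral.integral_sub hi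
      ((by simpa only [e] using hb.1 : IntervalIntegrable
      (fun y : ℝ ↦ y ^ (p - 1) * (1 - y) ^ (-(2 * p))) volume 0 1).const_mul _),
      intervalIntegral.integral_const_mul] at hF
    simp only [e] at hF
    rw [hb.2] at hF
    rw [Real.Gamma_add_one hp0.ne']
    have : p + (1 - 2 * p) = 1 - p := by ring
    rw [this] at hF
    rw [sub_eq_iff_eq_add.1 hF]
    ring
  · have : ContinuousAt (fun y : ℝ ↦ (1 - y ^ p) ^ 2 * (1 - y) ^ (-(1 + 2 * p)) / (1 + 2 * p) +
        1 / (1 + 2 * p) * ((y ^ p - y ^ (2 * p)) * (1 - y) ^ (-(2 * p)))) 0 := by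
      have c1 : ContinuousAt (fun y : ℝ ↦ y ^ p) 0 :=
        Real.continuousAt_rpow_const _ _ (Or.inr hp0.le)
      have c2 : ContinuousAt (fun y : ℝ ↦ y ^ (2 * p)) 0 :=
        Real.continuousAt_rpow_const _ _ (Or.inr (by linarith))
      have c3 (c : ℝ) : ContinuousAt (fun y : ℝ ↦ (1 - y) ^ c) 0 :=
        (continuousAt_const.sub continuousAt_id).rpow_const (Or.inl (by simp))
      exact ((((continuousAt_const.sub c1).pow 2).mul (c3 _)).div_const _).add
        (continuousAt_const.mul ((c1.sub c2).mul (c3 _)))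
    have h2 := this.tendsto
    simp only [Real.zero_rpow hp0.ne', Real.zero_rpow (by linarith : 2 * p ≠ 0), sub_zero,
      Real.one_rpow, mul_one, one_pow, sub_self, mul_zero, add_zero] at h2
    exact h2.mono_left nhdsWithin_le_nhds
  · have hlim : Tendsto (fun y : ℝ ↦ 1 / (1 + 2 * p) * (1 - y) ^ (1 - 2 * p) * 2) (𝓝[<] 1)
        (𝓝 0) := by
      have : ContinuousAt (fun y : ℝ ↦ 1 / (1 + 2 * p) * (1 - y) ^ (1 - 2 * p) * 2) 1 :=
        (continuousAt_const.mul ((continuousAt_const.sub continuousAt_id).rpow_const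
          (Or.inr (by linarith)))).mul continuousAt_const
      have h2 := this.tendsto
      simp only [sub_self, Real.zero_rpow (by linarith : 1 - 2 * p ≠ 0), mul_zero, zero_mul] at h2
      exact h2.mono_left nhdsWithin_le_nhds
    refine squeeze_zero_norm' ?_ hlim
    filter_upwards [Ioo_mem_nhdsLT (zero_lt_one' ℝ)] with y hy
    obtain ⟨h0, h1⟩ := hy
    have h1' : 0 < 1 - y := by linarith
    have hy : y ≤ y ^ p := by
      conv_lhs => rw [← Real.rpow_one y]
      exact Real.rpow_le_rpow_of_exponent_ge h0 h1.le (by linarith)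
    have hy1 : y ^ p ≤ 1 := Real.rpow_le_one h0.le h1.le hp0.le
    have e5 : y ^ (2 * p) = y ^ p * y ^ p := by rw [← Real.rpow_add h0]; congr 1; ring
    have e6 : (1 - y) ^ (1 - 2 * p) = (1 - y) ^ 2 * (1 - y) ^ (-(1 + 2 * p)) := by
      rw [← Real.rpow_natCast, ← Real.rpow_add h1']; congr 1; push_cast; ring
    have e7 : (1 - y) ^ (1 - 2 * p) = (1 - y) * (1 - y) ^ (-(2 * p)) := by
      rw [← Real.rpow_one_add' h1'.le (by linarith)]; congr 1
    have n1 : (1 - y ^ p) ^ 2 * (1 - y) ^ (-(1 + 2 * p)) ≤ (1 - y) ^ (1 - 2 * p) := by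
      rw [e6]; gcongr
    have n2 : (y ^ p - y ^ (2 * p)) * (1 - y) ^ (-(2 * p)) ≤ (1 - y) ^ (1 - 2 * p) := by
      rw [e7, e5]
      refine mul_le_mul_of_nonneg_right ?_ (by positivity)
      nlinarith
    have n3 : 0 ≤ (y ^ p - y ^ (2 * p)) * (1 - y) ^ (-(2 * p)) := by
      rw [e5]
      have : 0 ≤ y ^ p - y ^ p * y ^ p := by nlinarith
      positivity
    rw [Real.norm_of_nonneg (by positivity), div_eq_inv_mul, ← one_div, ← mul_add, mul_assoc]
    gcongr
    linarith

theorem kappa_one_eq (hα1 : 1 < α) (hα2 : α < 2) :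
    kappa 1 α = ∫ y in (0 : ℝ)..1, (1 - y ^ ((α - 1) / 2)) ^ 2 * (1 - y) ^ (-(1 + α)) := by
  have h := integral_constant (p := (α - 1) / 2) (by linarith) (by linarith)
  have e : -(2 + 2 * ((α - 1) / 2)) = -(1 + α) := by ring
  rw [e] at h
  rw [h, kappa]
  have hd := Real.Gamma_mul_Gamma_add_half ((2 - α) / 2)
  have e1 : 2 * ((2 - α) / 2) = 2 - α := by ring
  have e2 : (2 - α) / 2 + 1 / 2 = (3 - α) / 2 := by ring
  rw [e1, e2] at hd
  have e3 : 1 - 2 * ((α - 1) / 2) = 2 - α := by ring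
  have e4 : 1 - (α - 1) / 2 = (3 - α) / 2 := by ring
  have e5 : (α - 1) / 2 + 1 = (1 + α) / 2 := by ring
  have e6 : 1 + 2 * ((α - 1) / 2) = α := by ring
  rw [e3, e4, e5, e6]
  have g1 : Real.Gamma ((1 + α) / 2) ≠ 0 := (Real.Gamma_pos_of_pos (by linarith)).ne'
  have g2 : Real.Gamma ((3 - α) / 2) ≠ 0 := (Real.Gamma_pos_of_pos (by linarith)).ne'
  have g3 : Real.Gamma ((2 - α) / 2) = Real.Gamma (2 - α) * 2 ^ (1 - (2 - α)) * √Real.pi /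
      Real.Gamma ((3 - α) / 2) := by rw [eq_div_iff g2, hd]
  have e7 : (2 : ℝ) ^ (1 - α) * 2 ^ (1 - (2 - α)) = 1 := by
    rw [← Real.rpow_add two_pos, show 1 - α + (1 - (2 - α)) = 0 by ring, Real.rpow_zero]
  have hpi : √Real.pi ≠ 0 := by positivity
  simp only [Nat.cast_one, sub_self, zero_div, Real.rpow_zero, one_mul, div_self g1]
  rw [g3]
  congr 2
  field_simp
  linear_combination Real.Gamma (2 - α) * e7

theorem kappa_one_pos (hα1 : 1 < α) (hα2 : α < 2) : 0 < kappa 1 α := by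
  have h := integrable_constant_integrand (p := (α - 1) / 2) (by linarith) (by linarith)
  have e : -(2 + 2 * ((α - 1) / 2)) = -(1 + α) := by ring
  rw [e] at h
  rw [kappa_one_eq hα1 hα2]
  refine intervalIntegral.intervalIntegral_pos_of_pos_on h ?_ one_pos
  rintro y ⟨h0, h1⟩
  have : y ^ ((α - 1) / 2) < 1 := Real.rpow_lt_one h0.le h1 (by linarith)
  have h2 : 0 < 1 - y ^ ((α - 1) / 2) := by linarith
  have h3 : 0 < 1 - y := by linarith
  positivity

theorem image_neg_log : (fun y : ℝ ↦ -Real.log y) '' Ioo 0 1 = Ioi 0 := by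
  ext r
  simp only [mem_image, mem_Ioo, mem_Ioi]
  constructor
  · rintro ⟨y, hy, rfl⟩
    simpa using Real.log_neg hy.1 hy.2
  · intro hr
    exact ⟨Real.exp (-r), ⟨Real.exp_pos _, by simpa using hr⟩, by simp⟩

theorem lintegral_logKernel (hα1 : 1 < α) (hα2 : α < 2) :
    ∫⁻ r in Ioi (0 : ℝ), ENNReal.ofReal
      ((Real.exp ((α - 1) / 2 * r) + Real.exp (-((α - 1) / 2 * r)) - 2) * logKernel α r) =
      ENNReal.ofReal (kappa 1 α) := by
  have h := integrable_constant_integrand (p := (α - 1) / 2) (by linarith) (by linarith)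
  have e : -(2 + 2 * ((α - 1) / 2)) = -(1 + α) := by ring
  rw [e, intervalIntegrable_iff_integrableOn_Ioo_of_le zero_le_one] at h
  rw [kappa_one_eq hα1 hα2, intervalIntegral.integral_of_le zero_le_one,
    integral_Ioc_eq_integral_Ioo, ofReal_integral_eq_lintegral_ofReal h, ← image_neg_log,
    lintegral_image_eq_lintegral_abs_deriv_mul (f' := fun y ↦ -y⁻¹) measurableSet_Ioo]
  · refine setLIntegral_congr_fun measurableSet_Ioo ?_
    rintro y ⟨h0, h1⟩
    have h1' : 0 < 1 - y := by linarith
    dsimp only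
    rw [← ENNReal.ofReal_mul (abs_nonneg _), abs_neg, abs_of_pos (inv_pos.2 h0)]
    congr 1
    have a1 : Real.exp ((α - 1) / 2 * -Real.log y) = (y ^ ((α - 1) / 2))⁻¹ := by
      rw [← Real.rpow_neg h0.le, Real.rpow_def_of_pos h0]; congr 1; ring
    have a2 : Real.exp (-((α - 1) / 2 * -Real.log y)) = y ^ ((α - 1) / 2) := by
      rw [Real.rpow_def_of_pos h0]; congr 1; ring
    have a3 : 2 * Real.sinh (-Real.log y / 2) = y ^ (-(1 / 2) : ℝ) * (1 - y) := by
      rw [Real.sinh_eq, mul_sub, mul_one, ← Real.rpow_add_one h0.ne', Real.rpow_def_of_pos h0,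
        Real.rpow_def_of_pos h0]
      ring_nf
    have a4 : y⁻¹ * (y ^ (-(1 / 2) : ℝ)) ^ (-(1 + α)) = y ^ ((α - 1) / 2) := by
      rw [← Real.rpow_mul h0.le, ← Real.rpow_neg_one, ← Real.rpow_add h0]; congr 1; ring
    rw [a1, a2, logKernel, a3, Real.mul_rpow (by positivity) h1'.le]
    have hA : 0 < y ^ ((α - 1) / 2) := by positivity
    calc _ = ((y ^ ((α - 1) / 2))⁻¹ + y ^ ((α - 1) / 2) - 2) *
          (y⁻¹ * (y ^ (-(1 / 2) : ℝ)) ^ (-(1 + α))) * (1 - y) ^ (-(1 + α)) := by ring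
      _ = _ := by rw [a4]; field_simp; ring
  · intro y hy
    exact ((Real.hasDerivAt_log hy.1.ne').neg).hasDerivWithinAt
  · intro x hx y hy hxy
    exact Real.log_injOn_pos hx.1 hy.1 (neg_injective hxy)
  · refine (ae_restrict_iff' measurableSet_Ioo).2 (ae_of_all _ ?_)
    rintro y ⟨h0, h1⟩
    have h1' : 0 < 1 - y := by linarith
    simp only [Pi.zero_apply]
    positivity

end Constant


/-- The Gagliardo energy on `J ⊆ ℝ`, integrated over the pairs `x < y`. -/
def energy {𝕜 : Type*} [RCLike 𝕜] (α : ℝ) (J : Set ℝ) (g : ℝ → 𝕜) : ℝ≥0∞ :=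
  ∫⁻ x in J, ∫⁻ y in J ∩ Ioi x, ‖g x - g y‖ₑ ^ 2 / ENNReal.ofReal (y - x) ^ (1 + α)

section Coordinates

variable {𝕜 : Type*} [RCLike 𝕜] {α : ℝ} {φ ρ : ℝ → ℝ}

theorem logKernel_nonneg {r : ℝ} (hr : 0 < r) : 0 ≤ logKernel α r := by
  have : 0 < Real.sinh (r / 2) := Real.sinh_pos_iff.2 (by linarith)
  unfold logKernel; positivity

theorem measurable_logKernel : Measurable (logKernel α) := by
  unfold logKernel; fun_prop

theorem strictMono_of_hasDerivAt_inv (hρ : ∀ s, 0 < ρ s) (hφ : ∀ s, HasDerivAt φ (ρ s)⁻¹ s) :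
    StrictMono φ :=
  strictMono_of_deriv_pos fun s ↦ by rw [(hφ s).deriv]; exact inv_pos.2 (hρ s)

theorem energy_range_eq (hρ : ∀ s, 0 < ρ s) (hρm : Measurable ρ)
    (hφ : ∀ s, HasDerivAt φ (ρ s)⁻¹ s)
    (hd : ∀ s t, φ t - φ s = 2 * Real.sinh ((t - s) / 2) / √(ρ s * ρ t))
    {g : ℝ → 𝕜} (hg : Measurable g) :
    energy α (range φ) g = ∫⁻ r in Ioi (0 : ℝ), ENNReal.ofReal (logKernel α r) *
      ∫⁻ s, ENNReal.ofReal ((ρ s * ρ (s + r)) ^ ((α - 1) / 2)) *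
        ‖g (φ s) - g (φ (s + r))‖ₑ ^ 2 := by
  have hmono := strictMono_of_hasDerivAt_inv hρ hφ
  have hφm : Measurable φ := hmono.monotone.measurable
  have hinner : ∀ s, range φ ∩ Ioi (φ s) = (fun r ↦ φ (s + r)) '' Ioi 0 := by
    intro s
    ext y
    simp only [mem_inter_iff, mem_range, mem_Ioi, mem_image]
    constructor
    · rintro ⟨⟨t, rfl⟩, ht⟩
      exact ⟨t - s, sub_pos.2 (hmono.lt_iff_lt.1 ht), by simp⟩
    · rintro ⟨r, hr, rfl⟩
      exact ⟨⟨_, rfl⟩, hmono (by linarith)⟩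
  have hker : ∀ s r : ℝ, 0 < r →
      ENNReal.ofReal (ρ s)⁻¹ * (ENNReal.ofReal (ρ (s + r))⁻¹ * (‖g (φ s) - g (φ (s + r))‖ₑ ^ 2 /
        ENNReal.ofReal (φ (s + r) - φ s) ^ (1 + α))) =
      ENNReal.ofReal (logKernel α r) * (ENNReal.ofReal ((ρ s * ρ (s + r)) ^ ((α - 1) / 2)) *
        ‖g (φ s) - g (φ (s + r))‖ₑ ^ 2) := by
    intro s r hr
    have h1 := hρ s
    have h2 := hρ (s + r)
    have hsh : 0 < Real.sinh (r / 2) := Real.sinh_pos_iff.2 (by linarith)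
    have hpos : 0 < 2 * Real.sinh (r / 2) / √(ρ s * ρ (s + r)) := by positivity
    rw [hd, show s + r - s = r by ring, ENNReal.ofReal_rpow_of_pos hpos, div_eq_mul_inv,
      ← ENNReal.ofReal_inv_of_pos (by positivity)]
    rw [mul_comm (‖_‖ₑ ^ 2), ← mul_assoc, ← mul_assoc, ← mul_assoc,
      ← ENNReal.ofReal_mul (by positivity), ← ENNReal.ofReal_mul (by positivity),
      ← ENNReal.ofReal_mul (logKernel_nonneg hr)]
    congr 2
    rw [Real.div_rpow (by positivity) (by positivity), inv_div, logKernel,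
      Real.rpow_neg (by positivity), Real.sqrt_eq_rpow, ← Real.rpow_mul (by positivity),
      ← mul_inv, show (α - 1) / 2 = 1 / 2 * (1 + α) - 1 by ring,
      Real.rpow_sub_one (by positivity)]
    field_simp
  have hmeas : Measurable fun z : ℝ × ℝ ↦ ENNReal.ofReal (logKernel α z.2) *
      (ENNReal.ofReal ((ρ z.1 * ρ (z.1 + z.2)) ^ ((α - 1) / 2)) *
        ‖g (φ z.1) - g (φ (z.1 + z.2))‖ₑ ^ 2) := by
    have := measurable_logKernel (α := α)
    fun_prop
  unfold energy
  calc _ = ∫⁻ s, ENNReal.ofReal |(ρ s)⁻¹| * ∫⁻ y in range φ ∩ Ioi (φ s),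
        ‖g (φ s) - g y‖ₑ ^ 2 / ENNReal.ofReal (y - φ s) ^ (1 + α) := by
        rw [← image_univ, lintegral_image_eq_lintegral_abs_deriv_mul MeasurableSet.univ
          (fun s _ ↦ (hφ s).hasDerivWithinAt) hmono.injective.injOn, Measure.restrict_univ]
    _ = ∫⁻ s, ∫⁻ r in Ioi (0 : ℝ), ENNReal.ofReal (logKernel α r) *
          (ENNReal.ofReal ((ρ s * ρ (s + r)) ^ ((α - 1) / 2)) *
          ‖g (φ s) - g (φ (s + r))‖ₑ ^ 2) := by
        refine lintegral_congr fun s ↦ ?_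
        rw [hinner, lintegral_image_eq_lintegral_abs_deriv_mul (f' := fun r ↦ (ρ (s + r))⁻¹)
          measurableSet_Ioi, ← lintegral_const_mul' _ _ ENNReal.ofReal_ne_top]
        · refine setLIntegral_congr_fun measurableSet_Ioi fun r hr ↦ ?_
          rw [abs_of_pos (inv_pos.2 (hρ _)), abs_of_pos (inv_pos.2 (hρ _)), hker s r hr]
        · intro r _
          exact ((hφ (s + r)).comp_const_add s r).hasDerivWithinAt
        · intro r _ r' _ h
          simpa using hmono.injective h
    _ = ∫⁻ r in Ioi (0 : ℝ), ∫⁻ s, ENNReal.ofReal (logKernel α r) *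
          (ENNReal.ofReal ((ρ s * ρ (s + r)) ^ ((α - 1) / 2)) *
          ‖g (φ s) - g (φ (s + r))‖ₑ ^ 2) := lintegral_lintegral_swap hmeas.aemeasurable
    _ = _ := by
        refine lintegral_congr fun r ↦ ?_
        rw [lintegral_const_mul' _ _ ENNReal.ofReal_ne_top]

theorem lintegral_range_weight_eq (hρ : ∀ s, 0 < ρ s) (hφ : ∀ s, HasDerivAt φ (ρ s)⁻¹ s)
    {W : ℝ → ℝ≥0∞} (hW : ∀ s, W (φ s) = ENNReal.ofReal (ρ s) ^ α) (g : ℝ → 𝕜) :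
    ∫⁻ x in range φ, ‖g x‖ₑ ^ 2 * W x =
      ∫⁻ s, ENNReal.ofReal (ρ s ^ (α - 1)) * ‖g (φ s)‖ₑ ^ 2 := by
  have hmono := strictMono_of_hasDerivAt_inv hρ hφ
  rw [← image_univ, lintegral_image_eq_lintegral_abs_deriv_mul MeasurableSet.univ
          (fun s _ ↦ (hφ s).hasDerivWithinAt) hmono.injective.injOn, Measure.restrict_univ]
  refine lintegral_congr fun s ↦ ?_
  rw [hW, ENNReal.ofReal_rpow_of_pos (hρ s), mul_comm (‖_‖ₑ ^ 2), ← mul_assoc,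
    ← ENNReal.ofReal_mul (abs_nonneg _), abs_of_pos (inv_pos.2 (hρ s)),
    Real.rpow_sub_one (hρ s).ne', inv_mul_eq_div]

theorem weighted_sq_le (a b : ℝ) (ha : 0 < a) (hb : 0 < b) (u v : 𝕜) :
    ENNReal.ofReal (a * b) * ‖u‖ₑ ^ 2 + ENNReal.ofReal (a * b) * ‖v‖ₑ ^ 2 ≤
      ENNReal.ofReal (a * b) * ‖u - v‖ₑ ^ 2 +
        (ENNReal.ofReal (a ^ 2) * ‖u‖ₑ ^ 2 + ENNReal.ofReal (b ^ 2) * ‖v‖ₑ ^ 2) := by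
  have key : a * b * ‖u‖ ^ 2 + a * b * ‖v‖ ^ 2 ≤
      a * b * ‖u - v‖ ^ 2 + (a ^ 2 * ‖u‖ ^ 2 + b ^ 2 * ‖v‖ ^ 2) := by
    have h1 : ‖u - v‖ ^ 2 = ‖u‖ ^ 2 - 2 * RCLike.re (inner 𝕜 u v) + ‖v‖ ^ 2 := norm_sub_sq u v
    have h2 : RCLike.re (inner 𝕜 u v) ≤ ‖u‖ * ‖v‖ := re_inner_le_norm u v
    have h3 := mul_le_mul_of_nonneg_left h2 (mul_pos ha hb).le
    rw [h1]
    nlinarith [sq_nonneg (a * ‖u‖ - b * ‖v‖)]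
  have hconv : ∀ (c : ℝ) (w : 𝕜), 0 ≤ c →
      ENNReal.ofReal c * ‖w‖ₑ ^ 2 = ENNReal.ofReal (c * ‖w‖ ^ 2) := fun c w hc ↦ by
    rw [ENNReal.ofReal_mul hc, ENNReal.ofReal_pow (norm_nonneg _), ofReal_norm]
  rw [hconv _ _ (by positivity), hconv _ _ (by positivity), hconv _ _ (by positivity),
    hconv _ _ (by positivity), hconv _ _ (by positivity), ← ENNReal.ofReal_add (by positivity)
    (by positivity), ← ENNReal.ofReal_add (by positivity) (by positivity),
    ← ENNReal.ofReal_add (by positivity) (by positivity)]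
  exact ENNReal.ofReal_le_ofReal key

/-- The Hardy inequality for a fixed increment `r`, for a weight `c` that is a supersolution. -/
theorem increment_hardy {c : ℝ → ℝ} (hc : ∀ s, 0 < c s) (hcm : Measurable c) {G : ℝ → 𝕜}
    (hG : Measurable G) (hfin : ∫⁻ s, ENNReal.ofReal (c s ^ 2) * ‖G s‖ₑ ^ 2 ≠ ⊤) {m r : ℝ}
    (hm : 2 ≤ m) (hcr : ∀ s, m * c s ≤ c (s + r) + c (s - r)) :
    ENNReal.ofReal (m - 2) * ∫⁻ s, ENNReal.ofReal (c s ^ 2) * ‖G s‖ₑ ^ 2 ≤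
      ∫⁻ s, ENNReal.ofReal (c s * c (s + r)) * ‖G s - G (s + r)‖ₑ ^ 2 := by
  set N := ∫⁻ s, ENNReal.ofReal (c s ^ 2) * ‖G s‖ₑ ^ 2 with hN
  set X := ∫⁻ s, ENNReal.ofReal (c s * c (s + r)) * ‖G s - G (s + r)‖ₑ ^ 2
  have hN' : ∫⁻ s, ENNReal.ofReal (c (s + r) ^ 2) * ‖G (s + r)‖ₑ ^ 2 = N :=
    lintegral_add_right_eq_self (μ := volume)
      (fun s ↦ ENNReal.ofReal (c s ^ 2) * ‖G s‖ₑ ^ 2) r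
  have h1 : (∫⁻ s, ENNReal.ofReal (c s * c (s + r)) * ‖G s‖ₑ ^ 2) +
      ∫⁻ s, ENNReal.ofReal (c s * c (s + r)) * ‖G (s + r)‖ₑ ^ 2 ≤ X + (N + N) := by
    rw [← lintegral_add_left (by fun_prop)]
    nth_rewrite 2 [← hN']
    rw [hN, ← lintegral_add_left (by fun_prop), ← lintegral_add_left (by fun_prop)]
    exact lintegral_mono fun s ↦ weighted_sq_le _ _ (hc _) (hc _) _ _
  have h2 : ∫⁻ s, ENNReal.ofReal (c s * c (s + r)) * ‖G (s + r)‖ₑ ^ 2 =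
      ∫⁻ s, ENNReal.ofReal (c (s - r) * c s) * ‖G s‖ₑ ^ 2 := by
    rw [← lintegral_add_right_eq_self (μ := volume)
      (fun s ↦ ENNReal.ofReal (c (s - r) * c s) * ‖G s‖ₑ ^ 2) r]
    simp
  have h3 : ENNReal.ofReal m * N ≤ X + (N + N) := by
    refine le_trans ?_ h1
    rw [h2, ← lintegral_add_left (by fun_prop), hN, ← lintegral_const_mul' _ _
      ENNReal.ofReal_ne_top]
    refine lintegral_mono fun s ↦ ?_
    dsimp only
    rw [← mul_assoc, ← add_mul, ← ENNReal.ofReal_mul (by linarith),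
      ← ENNReal.ofReal_add (mul_pos (hc _) (hc _)).le (mul_pos (hc _) (hc _)).le]
    gcongr
    nlinarith [hcr s, hc s]
  rw [ENNReal.ofReal_sub _ zero_le_two, ENNReal.sub_mul fun _ _ ↦ hfin]
  refine tsub_le_iff_right.2 (h3.trans_eq ?_)
  rw [← two_mul, ENNReal.ofReal_ofNat]

theorem energy_range_ge (hα1 : 1 < α) (hα2 : α < 2) (hρ : ∀ s, 0 < ρ s) (hρm : Measurable ρ)
    (hφ : ∀ s, HasDerivAt φ (ρ s)⁻¹ s)
    (hd : ∀ s t, φ t - φ s = 2 * Real.sinh ((t - s) / 2) / √(ρ s * ρ t))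
    (hsup : ∀ s r, (Real.exp ((α - 1) / 2 * r) + Real.exp (-((α - 1) / 2 * r))) *
      ρ s ^ ((α - 1) / 2) ≤ ρ (s + r) ^ ((α - 1) / 2) + ρ (s - r) ^ ((α - 1) / 2))
    {W : ℝ → ℝ≥0∞} (hW : ∀ s, W (φ s) = ENNReal.ofReal (ρ s) ^ α) {g : ℝ → 𝕜}
    (hg : Measurable g) (hfin : ∫⁻ x in range φ, ‖g x‖ₑ ^ 2 * W x ≠ ⊤) :
    ENNReal.ofReal (kappa 1 α) * ∫⁻ x in range φ, ‖g x‖ₑ ^ 2 * W x ≤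
      energy α (range φ) g := by
  have hmono := strictMono_of_hasDerivAt_inv hρ hφ
  have hφm : Measurable φ := hmono.monotone.measurable
  rw [lintegral_range_weight_eq hρ hφ hW] at hfin ⊢
  rw [energy_range_eq hρ hρm hφ hd hg, ← lintegral_logKernel hα1 hα2,
    ← lintegral_mul_const' _ _ hfin]
  have hsq : ∀ s, ρ s ^ (α - 1) = (ρ s ^ ((α - 1) / 2)) ^ 2 := fun s ↦ by
    rw [← Real.rpow_natCast, ← Real.rpow_mul (hρ s).le]; congr 1; push_cast; ring
  simp only [hsq] at hfin ⊢
  refine setLIntegral_mono' measurableSet_Ioi fun r hr ↦ ?_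
  rw [ENNReal.ofReal_mul' (logKernel_nonneg hr), mul_comm (ENNReal.ofReal _), mul_assoc]
  gcongr
  have h2 : 2 ≤ Real.exp ((α - 1) / 2 * r) + Real.exp (-((α - 1) / 2 * r)) := by
    have := Real.one_le_cosh ((α - 1) / 2 * r)
    rw [Real.cosh_eq] at this
    linarith
  refine (increment_hardy (c := fun s ↦ ρ s ^ ((α - 1) / 2)) (G := fun s ↦ g (φ s))
    (fun s ↦ Real.rpow_pos_of_pos (hρ s) _) (by fun_prop) (by fun_prop) hfin h2
    (fun s ↦ hsup s r)).trans_eq ?_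
  refine lintegral_congr fun s ↦ ?_
  rw [Real.mul_rpow (hρ _).le (hρ _).le]

end Coordinates


section Interval

variable {𝕜 : Type*} [RCLike 𝕜] {α : ℝ}

theorem rpow_cosh_supersolution {q : ℝ} (hq0 : 0 ≤ q) (hq1 : q ≤ 1) {A R : ℝ} (hA : 0 < A)
    (hR : 0 < R) :
    (R ^ q + R⁻¹ ^ q) * (A + A⁻¹) ^ q ≤
      (A * R + (A * R)⁻¹) ^ q + (A * R⁻¹ + (A * R⁻¹)⁻¹) ^ q := by
  have hc := Real.concaveOn_rpow hq0 hq1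
  have hT : 0 < A + A⁻¹ := by positivity
  have hl : A / (A + A⁻¹) + A⁻¹ / (A + A⁻¹) = 1 := by field_simp
  have h1 := hc.2 (mem_Ici.2 hR.le) (mem_Ici.2 (inv_pos.2 hR).le)
    (by positivity : 0 ≤ A / (A + A⁻¹)) (by positivity : 0 ≤ A⁻¹ / (A + A⁻¹)) hl
  have h2 := hc.2 (mem_Ici.2 (inv_pos.2 hR).le) (mem_Ici.2 hR.le)
    (by positivity : 0 ≤ A / (A + A⁻¹)) (by positivity : 0 ≤ A⁻¹ / (A + A⁻¹)) hl
  simp only [smul_eq_mul] at h1 h2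
  have e1 : A * R + (A * R)⁻¹ = (A / (A + A⁻¹) * R + A⁻¹ / (A + A⁻¹) * R⁻¹) * (A + A⁻¹) := by
    field_simp
  have e2 : A * R⁻¹ + (A * R⁻¹)⁻¹ =
      (A / (A + A⁻¹) * R⁻¹ + A⁻¹ / (A + A⁻¹) * R) * (A + A⁻¹) := by
    field_simp
  rw [e1, e2, Real.mul_rpow (by positivity) hT.le, Real.mul_rpow (by positivity) hT.le, ← add_mul]
  refine mul_le_mul_of_nonneg_right ?_ (by positivity)
  calc R ^ q + R⁻¹ ^ q = (A / (A + A⁻¹) + A⁻¹ / (A + A⁻¹)) * (R ^ q + R⁻¹ ^ q) := by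
        rw [hl, one_mul]
    _ = _ := by ring
    _ ≤ _ := add_le_add h1 h2

theorem interval_hardy_of_finite (hα1 : 1 < α) (hα2 : α < 2) {a b : ℝ} (hab : a < b)
    {g : ℝ → 𝕜} (hg : Measurable g)
    (hfin : ∫⁻ x in Ioo a b, ‖g x‖ₑ ^ 2 *
      ((ENNReal.ofReal (x - a))⁻¹ + (ENNReal.ofReal (b - x))⁻¹) ^ α ≠ ⊤) :
    ENNReal.ofReal (kappa 1 α) * ∫⁻ x in Ioo a b, ‖g x‖ₑ ^ 2 *
      ((ENNReal.ofReal (x - a))⁻¹ + (ENNReal.ofReal (b - x))⁻¹) ^ α ≤ energy α (Ioo a b) g := by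
  have hL : 0 < b - a := sub_pos.2 hab
  set φ : ℝ → ℝ := fun s ↦ a + (b - a) * Real.sigmoid s with hφdef
  set ρ : ℝ → ℝ := fun s ↦ (Real.exp (s / 2) + (Real.exp (s / 2))⁻¹) ^ 2 / (b - a) with hρdef
  have hσ : ∀ s, Real.sigmoid s = Real.exp (s / 2) / (Real.exp (s / 2) + (Real.exp (s / 2))⁻¹) :=
    fun s ↦ by
      rw [Real.sigmoid_def, show -s = -(s / 2) + -(s / 2) by ring, Real.exp_add, Real.exp_neg]
      have := Real.exp_pos (s / 2)
      field_simp
  have hσ' : ∀ s, 1 - Real.sigmoid s =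
      (Real.exp (s / 2))⁻¹ / (Real.exp (s / 2) + (Real.exp (s / 2))⁻¹) := fun s ↦ by
    rw [hσ]; have := Real.exp_pos (s / 2); field_simp; ring
  have hσσ : ∀ s, Real.sigmoid s * (1 - Real.sigmoid s) =
      ((Real.exp (s / 2) + (Real.exp (s / 2))⁻¹) ^ 2)⁻¹ := fun s ↦ by
    rw [hσ', hσ]; have := Real.exp_pos (s / 2); field_simp
  have hρ : ∀ s, 0 < ρ s := fun s ↦ by positivity
  have hrange : range φ = Ioo a b := by
    have : φ = (fun x ↦ a + x) ∘ (fun x ↦ (b - a) * x) ∘ Real.sigmoid := rfl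
    rw [this, range_comp, range_comp, Real.range_sigmoid, Set.image_mul_left_Ioo hL]
    simp
  have hd : ∀ s, HasDerivAt φ (ρ s)⁻¹ s := fun s ↦ by
    refine (((Real.hasDerivAt_sigmoid s).const_mul (b - a)).const_add a).congr_deriv ?_
    rw [hσσ, ← div_eq_mul_inv, ← inv_div]
  rw [← hrange] at hfin ⊢
  refine energy_range_ge hα1 hα2 hρ (by fun_prop) hd ?_ ?_ ?_ hg hfin
  · intro s t
    have hsq : √(ρ s * ρ t) = (Real.exp (s / 2) + (Real.exp (s / 2))⁻¹) *
        (Real.exp (t / 2) + (Real.exp (t / 2))⁻¹) / (b - a) := by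
      rw [Real.sqrt_eq_iff_mul_self_eq (mul_pos (hρ _) (hρ _)).le (by positivity)]
      simp only [hρdef]; ring
    rw [hsq, Real.sinh_eq, show (t - s) / 2 = t / 2 - s / 2 by ring, Real.exp_sub,
      show -(t / 2 - s / 2) = s / 2 - t / 2 by ring, Real.exp_sub]
    simp only [hφdef, hσ]
    have := Real.exp_pos (s / 2)
    have := Real.exp_pos (t / 2)
    field_simp
    ring
  · intro s r
    have hpow : ∀ s, ρ s ^ ((α - 1) / 2) = (Real.exp (s / 2) + (Real.exp (s / 2))⁻¹) ^ (α - 1) /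
        (b - a) ^ ((α - 1) / 2) := fun s ↦ by
      rw [hρdef, Real.div_rpow (by positivity) hL.le, ← Real.rpow_natCast,
        ← Real.rpow_mul (by positivity)]
      congr 2; push_cast; ring
    have key := rpow_cosh_supersolution (q := α - 1) (by linarith) (by linarith)
      (Real.exp_pos (s / 2)) (Real.exp_pos (r / 2))
    have e1 : Real.exp ((s + r) / 2) = Real.exp (s / 2) * Real.exp (r / 2) := by
      rw [← Real.exp_add]; congr 1; ring
    have e2 : Real.exp ((s - r) / 2) = Real.exp (s / 2) * (Real.exp (r / 2))⁻¹ := by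
      rw [← Real.exp_neg, ← Real.exp_add]; congr 1; ring
    have e3 : Real.exp ((α - 1) / 2 * r) = Real.exp (r / 2) ^ (α - 1) := by
      rw [← Real.exp_mul]; congr 1; ring
    have e4 : Real.exp (-((α - 1) / 2 * r)) = (Real.exp (r / 2))⁻¹ ^ (α - 1) := by
      rw [← Real.exp_neg, ← Real.exp_mul]; congr 1; ring
    rw [hpow, hpow, hpow, e1, e2, e3, e4, ← mul_div_assoc, ← add_div]
    gcongr
  · intro s
    have h0 := Real.sigmoid_pos s
    have h1 := Real.sigmoid_lt_one s
    have h1' : 0 < 1 - Real.sigmoid s := by linarith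
    have e1 : φ s - a = (b - a) * Real.sigmoid s := by simp only [hφdef]; ring
    have e2 : b - φ s = (b - a) * (1 - Real.sigmoid s) := by simp only [hφdef]; ring
    rw [e1, e2, ← ENNReal.ofReal_inv_of_pos (by positivity),
      ← ENNReal.ofReal_inv_of_pos (by positivity),
      ← ENNReal.ofReal_add (by positivity) (by positivity)]
    congr 2
    have e3 : ρ s = ((b - a) * (Real.sigmoid s * (1 - Real.sigmoid s)))⁻¹ := by
      rw [hσσ, hρdef, mul_inv, inv_inv]; ring
    rw [e3]
    field_simp
    ring

theorem interval_hardy (hα1 : 1 < α) (hα2 : α < 2) {a b : ℝ} {g : ℝ → 𝕜} (hg : Continuous g)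
    (hgc : HasCompactSupport g) (ha : a ∉ tsupport g) (hb : b ∉ tsupport g) :
    ENNReal.ofReal (kappa 1 α) * ∫⁻ x in Ioo a b, ‖g x‖ₑ ^ 2 *
      ((ENNReal.ofReal (x - a))⁻¹ + (ENNReal.ofReal (b - x))⁻¹) ^ α ≤ energy α (Ioo a b) g := by
  rcases le_or_gt b a with hab | hab
  · simp [Ioo_eq_empty_of_le hab]
  refine interval_hardy_of_finite hα1 hα2 hab hg.measurable ?_
  obtain ⟨ε, hε, haε⟩ := Metric.isOpen_iff.1 (isClosed_tsupport g).isOpen_compl a ha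
  obtain ⟨δ, hδ, hbδ⟩ := Metric.isOpen_iff.1 (isClosed_tsupport g).isOpen_compl b hb
  obtain ⟨M, hM⟩ := hg.bounded_above_of_compact_support hgc
  have hbound : ∀ x ∈ Ioo a b, ‖g x‖ₑ ^ 2 *
      ((ENNReal.ofReal (x - a))⁻¹ + (ENNReal.ofReal (b - x))⁻¹) ^ α ≤
      ENNReal.ofReal M ^ 2 * ((ENNReal.ofReal ε)⁻¹ + (ENNReal.ofReal δ)⁻¹) ^ α := by
    intro x hx
    by_cases hxs : x ∈ tsupport g
    · have h1 : ε ≤ x - a := by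
        by_contra! h
        refine haε ?_ hxs
        rw [mem_ball, Real.dist_eq, abs_of_pos (sub_pos.2 hx.1)]; exact h
      have h2 : δ ≤ b - x := by
        by_contra! h
        refine hbδ ?_ hxs
        rw [mem_ball, Real.dist_eq, abs_sub_comm, abs_of_pos (sub_pos.2 hx.2)]; exact h
      gcongr
      rw [← ofReal_norm]
      exact ENNReal.ofReal_le_ofReal (hM x)
    · rw [image_eq_zero_of_notMem_tsupport hxs]
      simp
  refine ne_top_of_le_ne_top ?_ (setLIntegral_mono measurable_const hbound)
  rw [setLIntegral_const]
  have h1 : (ENNReal.ofReal ε)⁻¹ ≠ ⊤ := ENNReal.inv_ne_top.2 (by simpa using hε)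
  have h2 : (ENNReal.ofReal δ)⁻¹ ≠ ⊤ := ENNReal.inv_ne_top.2 (by simpa using hδ)
  have h3 : ((ENNReal.ofReal ε)⁻¹ + (ENNReal.ofReal δ)⁻¹) ^ α ≠ ⊤ :=
    ENNReal.rpow_ne_top_of_nonneg (by linarith) (ENNReal.add_ne_top.2 ⟨h1, h2⟩)
  exact ENNReal.mul_ne_top (ENNReal.mul_ne_top (by simp) h3) (by simp)

end Interval

section OpenSet

variable {𝕜 : Type*} [RCLike 𝕜] {α : ℝ}

/-- The distance from `x` to the complement of `J ⊆ ℝ`. -/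
def lineDist (J : Set ℝ) (x : ℝ) : ℝ≥0∞ := ⨅ (t : ℝ) (_ : x + t ∉ J), ENNReal.ofReal |t|

/-- The largest distance from `x` to a point of `J ⊆ ℝ`. -/
def lineDelta (J : Set ℝ) (x : ℝ) : ℝ≥0∞ := ⨆ (t : ℝ) (_ : x + t ∈ J), ENNReal.ofReal |t|

theorem lineWeight_le {J : Set ℝ} {a b x : ℝ} (hJ : Ioo a b ⊆ J) (hx : x ∈ Ioo a b) :
    (lineDist J x)⁻¹ + (lineDelta J x)⁻¹ ≤
      (ENNReal.ofReal (x - a))⁻¹ + (ENNReal.ofReal (b - x))⁻¹ := by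
  have h1 : ENNReal.ofReal (min (x - a) (b - x)) ≤ lineDist J x := by
    refine le_iInf₂ fun t ht ↦ ENNReal.ofReal_le_ofReal ?_
    by_contra! h
    rw [lt_min_iff, abs_lt, abs_lt] at h
    exact ht (hJ ⟨by linarith, by linarith⟩)
  have h2 : ENNReal.ofReal (max (x - a) (b - x)) ≤ lineDelta J x := by
    refine le_of_forall_lt fun c hc ↦ ?_
    have hct : c ≠ ⊤ := hc.ne_top
    have hc' : c.toReal < max (x - a) (b - x) := by
      have := (ENNReal.lt_ofReal_iff_toReal_lt hct).1 hc
      exact this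
    rcases lt_max_iff.1 hc' with h | h
    · obtain ⟨u, hu1, hu2⟩ := exists_between h
      have hu0 : 0 ≤ u := ENNReal.toReal_nonneg.trans hu1.le
      refine lt_of_lt_of_le ?_ (le_iSup₂_of_le (-u) (hJ ⟨by linarith, by linarith [hx.2]⟩) le_rfl)
      rwa [abs_neg, abs_of_nonneg hu0, ENNReal.lt_ofReal_iff_toReal_lt hct]
    · obtain ⟨u, hu1, hu2⟩ := exists_between h
      have hu0 : 0 ≤ u := ENNReal.toReal_nonneg.trans hu1.le
      refine lt_of_lt_of_le ?_ (le_iSup₂_of_le u (hJ ⟨by linarith [hx.1], by linarith⟩) le_rfl)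
      rwa [abs_of_nonneg hu0, ENNReal.lt_ofReal_iff_toReal_lt hct]
  refine (add_le_add (ENNReal.inv_le_inv.2 h1) (ENNReal.inv_le_inv.2 h2)).trans_eq ?_
  rcases le_total (x - a) (b - x) with h | h
  · rw [min_eq_left h, max_eq_right h]
  · rw [min_eq_right h, max_eq_left h, add_comm]

theorem exists_eq_Ioo_connectedComponentIn {J : Set ℝ} (hJ : IsOpen J) (hb : Bornology.IsBounded J)
    {x : ℝ} (hx : x ∈ J) :
    ∃ a b, connectedComponentIn J x = Ioo a b ∧ a ∉ J ∧ b ∉ J := by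
  set c := connectedComponentIn J x with hc
  have hxc : x ∈ c := mem_connectedComponentIn hx
  have hco : IsOpen c := hJ.connectedComponentIn
  have hcJ : c ⊆ J := connectedComponentIn_subset J x
  have hcp : IsPreconnected c := isPreconnected_connectedComponentIn
  have hbb := (hb.subset hcJ).bddBelow
  have hba := (hb.subset hcJ).bddAbove
  have heq : c = Ioo (sInf c) (sSup c) := by
    refine Subset.antisymm ?_ (IsConnected.Ioo_csInf_csSup_subset ⟨⟨x, hxc⟩, hcp⟩ hbb hba)
    rw [← interior_Icc]
    exact interior_maximal (subset_Icc_csInf_csSup hbb hba) hco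
  have hxI : x ∈ Ioo (sInf c) (sSup c) := heq ▸ hxc
  refine ⟨sInf c, sSup c, heq, fun h ↦ ?_, fun h ↦ ?_⟩
  · have hsub : Icc (sInf c) x ⊆ J := by
      rw [← Ioc_insert_left hxI.1.le]
      refine insert_subset h fun y hy ↦ hcJ ?_
      rw [heq]; exact ⟨hy.1, hy.2.trans_lt hxI.2⟩
    have := isPreconnected_Icc.subset_connectedComponentIn (right_mem_Icc.2 hxI.1.le) hsub
      (left_mem_Icc.2 hxI.1.le)
    rw [← hc] at this
    exact lt_irrefl _ (heq.subset this).1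
  · have hsub : Icc x (sSup c) ⊆ J := by
      rw [← Ico_insert_right hxI.2.le]
      refine insert_subset h fun y hy ↦ hcJ ?_
      rw [heq]; exact ⟨hxI.1.trans_le hy.1, hy.2⟩
    have := isPreconnected_Icc.subset_connectedComponentIn (left_mem_Icc.2 hxI.2.le) hsub
      (right_mem_Icc.2 hxI.2.le)
    rw [← hc] at this
    exact lt_irrefl _ (heq.subset this).2

theorem open_hardy (hα1 : 1 < α) (hα2 : α < 2) {J : Set ℝ} (hJ : IsOpen J) {g : ℝ → 𝕜}
    (hg : Continuous g) (hgc : HasCompactSupport g) (hgJ : tsupport g ⊆ J) :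
    ENNReal.ofReal (kappa 1 α) *
      ∫⁻ x in J, ‖g x‖ₑ ^ 2 * ((lineDist J x)⁻¹ + (lineDelta J x)⁻¹) ^ α ≤ energy α J g := by
  obtain ⟨R, hR⟩ := hgc.isCompact.isBounded.subset_ball 0
  set J' := J ∩ ball 0 R with hJ'
  have hJ'o : IsOpen J' := hJ.inter isOpen_ball
  have hJ'b : Bornology.IsBounded J' := isBounded_ball.subset inter_subset_right
  have hgJ' : tsupport g ⊆ J' := subset_inter hgJ hR
  set S : Set (Set ℝ) := (fun x ↦ connectedComponentIn J' x) '' J' with hS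
  have hSO : ∀ c ∈ S, IsOpen c := by rintro _ ⟨x, -, rfl⟩; exact hJ'o.connectedComponentIn
  have hSd : S.PairwiseDisjoint id := by
    rintro _ ⟨x, hx, rfl⟩ _ ⟨y, hy, rfl⟩ hne
    refine disjoint_left.2 fun z hzx hzy ↦ hne ?_
    dsimp only [id] at hzx hzy ⊢
    rw [connectedComponentIn_eq hzx, connectedComponentIn_eq hzy]
  have hSc : S.Countable := hSd.countable_of_isOpen hSO (by
    rintro _ ⟨x, hx, rfl⟩; exact ⟨x, mem_connectedComponentIn hx⟩)
  have hSU : ⋃ c ∈ S, id c = J' := by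
    refine Subset.antisymm (iUnion₂_subset ?_) fun x hx ↦ ?_
    · rintro _ ⟨x, -, rfl⟩; exact connectedComponentIn_subset J' x
    · exact mem_biUnion (mem_image_of_mem _ hx) (mem_connectedComponentIn hx)
  have hsum : ∀ h : ℝ → ℝ≥0∞, ∫⁻ x in J', h x = ∑' c : S, ∫⁻ x in (c : Set ℝ), h x := fun h ↦ by
    rw [← hSU]
    exact lintegral_biUnion hSc (fun c hc ↦ (hSO c hc).measurableSet) hSd h
  have h1 : ∫⁻ x in J, ‖g x‖ₑ ^ 2 * ((lineDist J x)⁻¹ + (lineDelta J x)⁻¹) ^ α =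
      ∫⁻ x in J', ‖g x‖ₑ ^ 2 * ((lineDist J x)⁻¹ + (lineDelta J x)⁻¹) ^ α := by
    rw [← lintegral_indicator hJ.measurableSet, ← lintegral_indicator hJ'o.measurableSet]
    refine lintegral_congr fun x ↦ ?_
    by_cases hx : x ∈ J'
    · rw [indicator_of_mem hx, indicator_of_mem hx.1]
    · rw [indicator_of_notMem hx]
      refine indicator_apply_eq_zero.2 fun _ ↦ ?_
      rw [image_eq_zero_of_notMem_tsupport fun h ↦ hx (hgJ' h)]
      simp
  have h2 : ∑' c : S, energy α (c : Set ℝ) g ≤ energy α J g := by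
    refine le_trans ?_ (lintegral_mono_set inter_subset_left : ∫⁻ x in J', ∫⁻ y in J ∩ Ioi x,
      ‖g x - g y‖ₑ ^ 2 / ENNReal.ofReal (y - x) ^ (1 + α) ≤ energy α J g)
    rw [hsum]
    refine ENNReal.tsum_le_tsum fun c ↦ lintegral_mono fun x ↦ lintegral_mono_set ?_
    refine inter_subset_inter_left _ (subset_trans ?_ (inter_subset_left : J' ⊆ J))
    obtain ⟨_, ⟨x, -, rfl⟩⟩ := c
    exact connectedComponentIn_subset J' x
  refine le_trans ?_ h2
  rw [h1, hsum, ← ENNReal.tsum_mul_left]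
  refine ENNReal.tsum_le_tsum ?_
  rintro ⟨_, ⟨x, hx, rfl⟩⟩
  obtain ⟨a, b, hab, ha, hb⟩ := exists_eq_Ioo_connectedComponentIn hJ'o hJ'b hx
  have hsub : Ioo a b ⊆ J :=
    hab ▸ (connectedComponentIn_subset J' x).trans inter_subset_left
  dsimp only
  rw [hab]
  refine le_trans ?_ (interval_hardy hα1 hα2 hg hgc (fun h ↦ ha (hgJ' h)) fun h ↦ hb (hgJ' h))
  gcongr ENNReal.ofReal (kappa 1 α) * ?_
  refine setLIntegral_mono' measurableSet_Ioo fun y hy ↦ ?_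
  gcongr ‖g y‖ₑ ^ 2 * ?_ ^ α
  exact lineWeight_le hsub hy

end OpenSet


/-- Fubini's theorem for the lines in the direction of a unit vector. -/
theorem exists_lintegral_fiber {n : ℕ} {w : E n} (hw : ‖w‖ = 1) :
    ∃ (m : ℕ) (L : E m →ₗᵢ[ℝ] E n), m + 1 = n ∧ (∀ z, inner ℝ w (L z) = 0) ∧
      (∀ x, ∃ z, ∃ s : ℝ, x = L z + s • w) ∧
      ∀ F : E n → ℝ≥0∞, Measurable F → ∫⁻ x, F x = ∫⁻ z, ∫⁻ s : ℝ, F (L z + s • w) := by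
  have hw0 : w ≠ 0 := by rintro rfl; simp at hw
  set K : Submodule ℝ (E n) := Submodule.span ℝ {w}
  set m := Module.finrank ℝ Kᗮ
  have hm : m + 1 = n := by
    have h := K.finrank_add_finrank_orthogonal
    rw [finrank_span_singleton hw0, finrank_euclideanSpace_fin] at h
    omega
  set e₂ : E m ≃ₗᵢ[ℝ] Kᗮ := (stdOrthonormalBasis ℝ Kᗮ).repr.symm
  set e₁ : ℝ ≃ₗᵢ[ℝ] K := LinearIsometryEquiv.toSpanUnitSingleton w hw
  set L : E m →ₗᵢ[ℝ] E n := Kᗮ.subtypeₗᵢ.comp e₂.toLinearIsometry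
  set Φ : WithLp 2 (ℝ × E m) ≃ₗᵢ[ℝ] E n :=
    (LinearIsometryEquiv.withLpProdCongr 2 e₁ e₂).trans K.orthogonalDecomposition.symm
  have hΦ : ∀ s z, Φ (WithLp.toLp 2 (s, z)) = L z + s • w := fun s z ↦ by
    have : (e₁ s : E n) = s • w := rfl
    simp [Φ, L, this, add_comm]
  refine ⟨m, L, hm, fun z ↦ ?_, fun x ↦ ?_, fun F hF ↦ ?_⟩
  · exact Submodule.inner_right_of_mem_orthogonal (Submodule.mem_span_singleton_self w) (e₂ z).2
  · obtain ⟨q, rfl⟩ := Φ.surjective x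
    exact ⟨q.snd, q.fst, hΦ q.fst q.snd⟩
  · have h1 := (WithLp.volume_preserving_symm_measurableEquiv_toLp_prod ℝ (E m)).symm
    have hΦm : Measurable fun q ↦ F (Φ q) := hF.comp Φ.continuous.measurable
    rw [← Φ.measurePreserving.lintegral_comp hF, ← h1.lintegral_comp hΦm, Measure.volume_eq_prod,
      lintegral_prod_symm' (fun q : ℝ × E m ↦ F (Φ ((MeasurableEquiv.toLp 2 (ℝ × E m)).symm.symm q)))
        (hΦm.comp (MeasurableEquiv.measurable _))]
    refine lintegral_congr fun z ↦ lintegral_congr fun s ↦ ?_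
    rw [← hΦ]
    rfl

/-- Integration in polar coordinates. -/
theorem lintegral_polar {n : ℕ} [NeZero n] {F : E n → ℝ≥0∞} (hF : Measurable F) :
    ∫⁻ x, F x = ∫⁻ w : sphere (0 : E n) 1, (∫⁻ r in Ioi (0 : ℝ),
      ENNReal.ofReal (r ^ (n - 1)) * F (r • (w : E n))) ∂(volume : Measure (E n)).toSphere := by
  have : Nontrivial (E n) := by
    have : Nonempty (Fin n) := ⟨⟨0, NeZero.pos n⟩⟩
    infer_instance
  have hmp := ((volume : Measure (E n)).measurePreserving_homeomorphUnitSphereProd).symm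
    (homeomorphUnitSphereProd (E n)).toMeasurableEquiv
  rw [finrank_euclideanSpace_fin] at hmp
  have h0 : ∫⁻ x, F x = ∫⁻ x : ({0}ᶜ : Set (E n)), F x ∂(Measure.comap Subtype.val volume) := by
    rw [lintegral_subtype_comap (measurableSet_singleton _).compl,
      restrict_compl_singleton]
  have hF' : Measurable fun x : ({0}ᶜ : Set (E n)) ↦ F x := hF.comp measurable_subtype_coe
  rw [h0, ← hmp.lintegral_comp hF', lintegral_prod _ (by
    exact (hF'.comp (MeasurableEquiv.measurable _)).aemeasurable)]
  refine lintegral_congr fun w ↦ ?_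
  rw [Measure.volumeIoiPow, lintegral_withDensity_eq_lintegral_mul _ (by fun_prop) (by
    exact hF'.comp
      ((MeasurableEquiv.measurable _).comp measurable_prodMk_left)), ←
    lintegral_subtype_comap measurableSet_Ioi]
  rfl

section Increment

variable {𝕜 : Type*} [RCLike 𝕜] {α : ℝ}

/-- The energy of `g` on `J ⊆ ℝ`, with the increments `r * c` for `r > 0`. -/
def increment (α : ℝ) (J : Set ℝ) (g : ℝ → 𝕜) (c : ℝ) : ℝ≥0∞ :=
  ∫⁻ s, ∫⁻ r in Ioi (0 : ℝ), J.indicator 1 s * J.indicator 1 (s + r * c) *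
    (‖g s - g (s + r * c)‖ₑ ^ 2 / ENNReal.ofReal r ^ (1 + α))

theorem energy_eq_increment {J : Set ℝ} (hJ : MeasurableSet J) (g : ℝ → 𝕜) :
    energy α J g = increment α J g 1 := by
  rw [energy, ← lintegral_indicator hJ]
  refine lintegral_congr fun s ↦ ?_
  by_cases hs : s ∈ J
  · rw [indicator_of_mem hs,
      ← lintegral_indicator (hJ.inter measurableSet_Ioi), ← lintegral_indicator measurableSet_Ioi,
      ← lintegral_add_left_eq_self (μ := volume) (indicator (J ∩ Ioi s) _) s]
    refine lintegral_congr fun r ↦ ?_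
    simp only [indicator, hs, mem_inter_iff, mem_Ioi, mul_one,
      lt_add_iff_pos_right, if_true, Pi.one_apply, one_mul, add_sub_cancel_left]
    split_ifs <;> simp_all
  · rw [indicator_of_notMem hs]
    simp [hs]

end Increment

section Gagliardo

variable {𝕜 : Type*} [RCLike 𝕜] {n : ℕ} {α : ℝ}

/-- The energy of `f` along the lines in the direction `w`. -/
def lineEnergy (α : ℝ) (Ω : Set (E n)) (f : E n → 𝕜) (w : E n) : ℝ≥0∞ :=
  ∫⁻ x, ∫⁻ r in Ioi (0 : ℝ), Ω.indicator 1 x * Ω.indicator 1 (x + r • w) *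
    (‖f x - f (x + r • w)‖ₑ ^ 2 / ENNReal.ofReal r ^ (1 + α))

theorem measurable_lineEnergy_integrand {Ω : Set (E n)} (hΩ : MeasurableSet Ω) {f : E n → 𝕜}
    (hf : Measurable f) {X : Type*} [MeasurableSpace X] {x w : X → E n} {r : X → ℝ}
    (hx : Measurable x) (hw : Measurable w) (hr : Measurable r) :
    Measurable fun q : X ↦ (Ω.indicator 1 (x q) * Ω.indicator 1 (x q + r q • w q) *
      (‖f (x q) - f (x q + r q • w q)‖ₑ ^ 2 / ENNReal.ofReal (r q) ^ (1 + α)) : ℝ≥0∞) := by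
  have hi : Measurable (Ω.indicator (1 : E n → ℝ≥0∞)) := measurable_one.indicator hΩ
  fun_prop

theorem gagliardo_eq_lintegral {Ω : Set (E n)} (hΩ : MeasurableSet Ω) {f : E n → 𝕜}
    (hf : Measurable f) :
    gagliardo α Ω f = ∫⁻ x, ∫⁻ y, Ω.indicator 1 x * Ω.indicator 1 y *
      (‖f x - f y‖ₑ ^ 2 / ‖x - y‖ₑ ^ ((n : ℝ) + α)) := by
  rw [gagliardo, ← lintegral_indicator (hΩ.prod hΩ), lintegral_prod _ (by
    exact (Measurable.indicator (by fun_prop) (hΩ.prod hΩ)).aemeasurable)]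
  refine lintegral_congr fun x ↦ lintegral_congr fun y ↦ ?_
  simp only [indicator, mem_prod, Pi.one_apply]
  split_ifs <;> simp_all

theorem gagliardo_eq_lintegral_lineEnergy [NeZero n] {Ω : Set (E n)} (hΩ : MeasurableSet Ω)
    {f : E n → 𝕜} (hf : Measurable f) :
    gagliardo α Ω f = ∫⁻ w : sphere (0 : E n) 1, lineEnergy α Ω f w
      ∂(volume : Measure (E n)).toSphere := by
  have hi : Measurable (Ω.indicator (1 : E n → ℝ≥0∞)) := measurable_one.indicator hΩ
  set G : E n → E n → ℝ≥0∞ := fun x y ↦ Ω.indicator 1 x * Ω.indicator 1 y *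
    (‖f x - f y‖ₑ ^ 2 / ‖x - y‖ₑ ^ ((n : ℝ) + α)) with hG
  have hGm : Measurable fun p : E n × E n ↦ G p.1 p.2 := by
    simp only [hG]; fun_prop
  have h2 : ∀ x, ∫⁻ y, G x y = ∫⁻ w : sphere (0 : E n) 1, (∫⁻ r in Ioi (0 : ℝ),
      Ω.indicator 1 x * Ω.indicator 1 (x + r • (w : E n)) *
      (‖f x - f (x + r • (w : E n))‖ₑ ^ 2 / ENNReal.ofReal r ^ (1 + α)))
      ∂(volume : Measure (E n)).toSphere := by
    intro x
    rw [← lintegral_add_left_eq_self (μ := volume) (fun y ↦ G x y) x, lintegral_polar (by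
      exact hGm.comp (by fun_prop : Measurable fun y ↦ (x, x + y)))]
    refine lintegral_congr fun w ↦ setLIntegral_congr_fun measurableSet_Ioi fun r hr ↦ ?_
    have hr : 0 < r := hr
    have hnorm : ‖x - (x + r • (w : E n))‖ₑ = ENNReal.ofReal r := by
      rw [sub_add_cancel_left, enorm_neg, enorm_smul, ← ofReal_norm (w : E n),
        norm_eq_of_mem_sphere w, Real.enorm_eq_ofReal hr.le]
      simp
    simp only [hG, hnorm]
    rw [mul_left_comm, ← mul_div_assoc, mul_comm (ENNReal.ofReal _), mul_div_assoc]
    congr 1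
    have hn : ((n - 1 : ℕ) : ℝ) = (n : ℝ) - 1 := by
      rw [Nat.cast_sub (NeZero.one_le), Nat.cast_one]
    rw [div_eq_mul_inv, div_eq_mul_inv]
    congr 1
    rw [ENNReal.ofReal_rpow_of_pos hr, ENNReal.ofReal_rpow_of_pos hr,
      ← ENNReal.ofReal_inv_of_pos (by positivity), ← ENNReal.ofReal_inv_of_pos (by positivity),
      ← ENNReal.ofReal_mul (by positivity)]
    congr 1
    rw [← Real.rpow_natCast, hn, ← Real.rpow_neg hr.le, ← Real.rpow_neg hr.le,
      ← Real.rpow_add hr]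
    congr 1; ring
  rw [gagliardo_eq_lintegral hΩ hf, lintegral_congr h2]
  rw [lintegral_lintegral_swap]
  · rfl
  · refine Measurable.aemeasurable ?_
    refine Measurable.lintegral_prod_right' (ν := volume.restrict (Ioi (0 : ℝ)))
      (f := fun q : (E n × sphere (0 : E n) 1) × ℝ ↦ Ω.indicator 1 q.1.1 *
        Ω.indicator 1 (q.1.1 + q.2 • (q.1.2 : E n)) *
        (‖f q.1.1 - f (q.1.1 + q.2 • (q.1.2 : E n))‖ₑ ^ 2 / ENNReal.ofReal q.2 ^ (1 + α))) ?_
    exact measurable_lineEnergy_integrand hΩ hf (by fun_prop) (by fun_prop) (by fun_prop)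

theorem lineEnergy_eq_lintegral_energy {m : ℕ} {w : E n} {L : E m →ₗᵢ[ℝ] E n}
    (hL : ∀ F : E n → ℝ≥0∞, Measurable F → ∫⁻ x, F x = ∫⁻ z, ∫⁻ s : ℝ, F (L z + s • w))
    {Ω : Set (E n)} (hΩ : MeasurableSet Ω) {f : E n → 𝕜} (hf : Measurable f) :
    lineEnergy α Ω f w =
      ∫⁻ z, energy α {s : ℝ | L z + s • w ∈ Ω} fun s ↦ f (L z + s • w) := by
  rw [lineEnergy, hL _ (Measurable.lintegral_prod_right' (ν := volume.restrict (Ioi (0 : ℝ)))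
    (f := fun q : E n × ℝ ↦ Ω.indicator 1 q.1 * Ω.indicator 1 (q.1 + q.2 • w) *
      (‖f q.1 - f (q.1 + q.2 • w)‖ₑ ^ 2 / ENNReal.ofReal q.2 ^ (1 + α)))
    (measurable_lineEnergy_integrand hΩ hf (by fun_prop) (by fun_prop) (by fun_prop)))]
  refine lintegral_congr fun z ↦ ?_
  have hline : Measurable fun s : ℝ ↦ L z + s • w := by fun_prop
  rw [energy_eq_increment (J := {s : ℝ | L z + s • w ∈ Ω}) (hline hΩ)]
  have hadd : ∀ s r : ℝ, L z + s • w + r • w = L z + (s + r) • w := fun s r ↦ by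
    rw [add_smul, add_assoc]
  simp only [increment, mul_one, hadd]
  rfl

end Gagliardo


section SphereMoment

variable {n : ℕ} {α : ℝ}

/-- The integral of `|⟨ν, w⟩| ^ α` over the unit sphere. -/
def sphereMoment (α : ℝ) (ν : E n) : ℝ≥0∞ :=
  ∫⁻ w : sphere (0 : E n) 1, ENNReal.ofReal |inner ℝ ν (w : E n)| ^ α
    ∂(volume : Measure (E n)).toSphere

/-- The value of `sphereMoment α ν` for a unit vector `ν`. -/
def sphereConst (n : ℕ) (α : ℝ) : ℝ :=
  2 * Real.pi ^ (((n : ℝ) - 1) / 2) * Real.Gamma ((1 + α) / 2) / Real.Gamma ((n + α) / 2)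

theorem sphereConst_pos (hα : 0 < α) : 0 < sphereConst n α := by
  have h1 : 0 < Real.Gamma ((1 + α) / 2) := Real.Gamma_pos_of_pos (by positivity)
  have h2 : 0 < Real.Gamma ((n + α) / 2) := Real.Gamma_pos_of_pos (by positivity)
  unfold sphereConst
  positivity

theorem kappa_eq_mul_sphereConst (hα : 0 < α) : kappa n α = kappa 1 α * (sphereConst n α / 2) := by
  have h1 : Real.Gamma ((1 + α) / 2) ≠ 0 := (Real.Gamma_pos_of_pos (by positivity)).ne'
  simp only [kappa, sphereConst, Nat.cast_one, sub_self, zero_div, Real.rpow_zero, div_self h1]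
  ring

theorem lintegral_Ioi_rpow_mul_gaussian {a : ℝ} (ha : -1 < a) :
    ∫⁻ r in Ioi (0 : ℝ), ENNReal.ofReal (r ^ a * Real.exp (-r ^ 2)) =
      ENNReal.ofReal (Real.Gamma ((a + 1) / 2) / 2) := by
  have h1 := integrableOn_rpow_mul_exp_neg_rpow ha two_pos
  have h2 := integral_rpow_mul_exp_neg_rpow two_pos ha
  simp only [Real.rpow_two] at h1 h2
  rw [← ofReal_integral_eq_lintegral_ofReal h1, h2]
  · congr 1; ring
  · refine (ae_restrict_iff' measurableSet_Ioi).2 (ae_of_all _ fun r hr ↦ ?_)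
    have : (0 : ℝ) < r := hr
    simp only [Pi.zero_apply]
    positivity

theorem lintegral_abs_rpow_mul_gaussian {a : ℝ} (ha : -1 < a) :
    ∫⁻ s : ℝ, ENNReal.ofReal (|s| ^ a * Real.exp (-s ^ 2)) =
      ENNReal.ofReal (Real.Gamma ((a + 1) / 2)) := by
  have h2 := integral_rpow_mul_exp_neg_rpow two_pos ha
  simp only [Real.rpow_two] at h2
  have h3 := integral_comp_abs (f := fun r ↦ r ^ a * Real.exp (-r ^ 2))
  simp only [sq_abs, h2] at h3
  have h4 : 2 * (1 / 2 * Real.Gamma ((a + 1) / 2)) = Real.Gamma ((a + 1) / 2) := by ring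
  rw [h4] at h3
  have hpos : 0 < Real.Gamma ((a + 1) / 2) := Real.Gamma_pos_of_pos (by linarith)
  have hint : Integrable fun s : ℝ ↦ |s| ^ a * Real.exp (-s ^ 2) := by
    by_contra h
    rw [integral_undef h] at h3
    exact hpos.ne h3
  rw [← ofReal_integral_eq_lintegral_ofReal hint (ae_of_all _ fun s ↦ by
    simp only [Pi.zero_apply]; positivity), h3]

theorem lintegral_gaussian (m : ℕ) :
    ∫⁻ z : E m, ENNReal.ofReal (Real.exp (-‖z‖ ^ 2)) =
      ENNReal.ofReal (Real.pi ^ ((m : ℝ) / 2)) := by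
  have h := GaussianFourier.integral_rexp_neg_mul_sq_norm (V := E m) one_pos
  simp only [div_one, finrank_euclideanSpace_fin, neg_one_mul] at h
  have hpos : 0 < Real.pi ^ ((m : ℝ) / 2) := by positivity
  have hint : Integrable fun z : E m ↦ Real.exp (-‖z‖ ^ 2) := by
    by_contra hn
    rw [integral_undef hn] at h
    exact hpos.ne h
  rw [← ofReal_integral_eq_lintegral_ofReal hint (ae_of_all _ fun s ↦ (Real.exp_pos _).le), h]

theorem sphereMoment_eq [NeZero n] (hα : 0 < α) {ν : E n} (hν : ‖ν‖ = 1) :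
    sphereMoment α ν = ENNReal.ofReal (sphereConst n α) := by
  obtain ⟨m, L, hm, hL, -, hFub⟩ := exists_lintegral_fiber hν
  set F : E n → ℝ≥0∞ := fun x ↦
    ENNReal.ofReal (|inner ℝ ν x| ^ α * Real.exp (-‖x‖ ^ 2)) with hF
  have hFm : Measurable F := by fun_prop
  have h1 : ∫⁻ x, F x = sphereMoment α ν * ENNReal.ofReal (Real.Gamma ((n + α) / 2) / 2) := by
    have hn : ((n - 1 : ℕ) : ℝ) = (n : ℝ) - 1 := by
      rw [Nat.cast_sub (NeZero.one_le), Nat.cast_one]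
    have hnn : (0 : ℝ) ≤ ((n - 1 : ℕ) : ℝ) := Nat.cast_nonneg _
    have hg := lintegral_Ioi_rpow_mul_gaussian (a := (n : ℝ) - 1 + α) (by linarith)
    rw [show (n : ℝ) - 1 + α + 1 = n + α by ring] at hg
    rw [lintegral_polar hFm, sphereMoment, ← lintegral_mul_const' _ _ ENNReal.ofReal_ne_top]
    refine lintegral_congr fun w ↦ ?_
    rw [← hg, ← lintegral_const_mul' _ _ (by
      exact ENNReal.rpow_ne_top_of_nonneg hα.le ENNReal.ofReal_ne_top)]
    refine setLIntegral_congr_fun measurableSet_Ioi fun r hr ↦ ?_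
    have hr : 0 < r := hr
    simp only [hF, inner_smul_right, norm_smul, norm_eq_of_mem_sphere, mul_one, abs_mul,
      Real.norm_eq_abs, abs_of_pos hr]
    rw [ENNReal.ofReal_rpow_of_nonneg (abs_nonneg _) hα.le,
      ← ENNReal.ofReal_mul (by positivity), ← ENNReal.ofReal_mul (by positivity)]
    congr 1
    rw [Real.mul_rpow hr.le (abs_nonneg _), Real.rpow_add hr, ← hn, Real.rpow_natCast]
    ring
  have h2 : ∫⁻ x, F x = ENNReal.ofReal (Real.pi ^ (((n : ℝ) - 1) / 2)) *
      ENNReal.ofReal (Real.Gamma ((1 + α) / 2)) := by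
    have hmn : (m : ℝ) = (n : ℝ) - 1 := by rw [← hm]; push_cast; ring
    rw [hFub F hFm, ← hmn, ← lintegral_gaussian, add_comm 1 α,
      ← lintegral_abs_rpow_mul_gaussian (by linarith), ← lintegral_mul_const' _ _ (by
        rw [lintegral_abs_rpow_mul_gaussian (by linarith)]; exact ENNReal.ofReal_ne_top)]
    refine lintegral_congr fun z ↦ ?_
    rw [← lintegral_const_mul' _ _ ENNReal.ofReal_ne_top]
    refine lintegral_congr fun s ↦ ?_
    have hin : inner ℝ ν (L z + s • ν) = s := by
      rw [inner_add_right, hL, inner_smul_right, real_inner_self_eq_norm_sq, hν]; simp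
    have hno : ‖L z + s • ν‖ ^ 2 = ‖z‖ ^ 2 + s ^ 2 := by
      rw [norm_add_sq_real, inner_smul_right, real_inner_comm, hL, norm_smul, hν,
        L.norm_map, mul_one, Real.norm_eq_abs, sq_abs]
      ring
    simp only [hF, hin, hno]
    rw [← ENNReal.ofReal_mul (by positivity), neg_add, Real.exp_add]
    congr 1; ring
  have hG : 0 < Real.Gamma ((n + α) / 2) := Real.Gamma_pos_of_pos (by positivity)
  have hG' : ENNReal.ofReal (Real.Gamma ((n + α) / 2) / 2) ≠ 0 := by
    simp only [ne_eq, ENNReal.ofReal_eq_zero, not_le]; positivity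
  rw [← ENNReal.mul_left_inj hG' ENNReal.ofReal_ne_top, ← h1, h2,
    ← ENNReal.ofReal_mul (by positivity), ← ENNReal.ofReal_mul (sphereConst_pos hα).le,
    sphereConst]
  congr 1
  field_simp

end SphereMoment

section Measurability

variable {n : ℕ} {Ω : Set (E n)}

theorem lowerSemicontinuous_dirDist (hΩ : IsOpen Ω) :
    LowerSemicontinuous fun p : E n × E n ↦ dirDist Ω p.1 p.2 := by
  intro p c hc
  obtain ⟨c', hc1, hc2⟩ := ENNReal.lt_iff_exists_nnreal_btwn.1 hc
  have hmem : ∀ t ∈ Icc (-(c' : ℝ)) c', p.2 + t • p.1 ∈ Ω := by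
    intro t ht
    by_contra h
    have h1 : dirDist Ω p.1 p.2 ≤ ENNReal.ofReal |t| := iInf₂_le t h
    have h2 : ENNReal.ofReal |t| ≤ c' := by
      rw [← ENNReal.ofReal_coe_nnreal]
      exact ENNReal.ofReal_le_ofReal (abs_le.2 ht)
    exact (hc2.trans_le (h1.trans h2)).false
  have hev := isCompact_Icc.eventually_forall_of_forall_eventually (x₀ := p)
    (K := Icc (-(c' : ℝ)) c') (P := fun p t ↦ p.2 + t • p.1 ∈ Ω) fun t ht ↦ by
      have hcont : Continuous fun z : (E n × E n) × ℝ ↦ z.1.2 + z.2 • z.1.1 := by fun_prop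
      exact (hΩ.preimage hcont).mem_nhds (x := (p, t)) (hmem t ht)
  filter_upwards [hev] with q hq
  refine hc1.trans_le (le_iInf₂ fun t ht ↦ ?_)
  rw [← ENNReal.ofReal_coe_nnreal]
  refine ENNReal.ofReal_le_ofReal ?_
  by_contra! h
  exact ht (hq t (abs_le.1 h.le))

theorem lowerSemicontinuous_dirDelta (hΩ : IsOpen Ω) :
    LowerSemicontinuous fun p : E n × E n ↦ dirDelta Ω p.1 p.2 := by
  intro p c hc
  simp only [dirDelta, lt_iSup_iff] at hc ⊢
  obtain ⟨t, ht, hct⟩ := hc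
  have hcont : Continuous fun p : E n × E n ↦ p.2 + t • p.1 := by fun_prop
  filter_upwards [(hΩ.preimage hcont).mem_nhds ht] with q hq using ⟨t, hq, hct⟩

theorem measurable_dirWeight (hΩ : IsOpen Ω) (α : ℝ) :
    Measurable fun p : E n × E n ↦ ((dirDist Ω p.1 p.2)⁻¹ + (dirDelta Ω p.1 p.2)⁻¹) ^ α :=
  ((lowerSemicontinuous_dirDist hΩ).measurable.inv.add
    (lowerSemicontinuous_dirDelta hΩ).measurable.inv).pow_const α

end Measurability

section GeneralDomain

variable {𝕜 : Type*} [RCLike 𝕜] {n : ℕ} {α : ℝ} {Ω : Set (E n)}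

theorem lineEnergy_hardy (hα1 : 1 < α) (hα2 : α < 2) (hΩ : IsOpen Ω) {f : E n → 𝕜}
    (hf : IsTestFun Ω f) {w : E n} (hw : ‖w‖ = 1) :
    ENNReal.ofReal (kappa 1 α) *
      ∫⁻ x in Ω, ‖f x‖ₑ ^ 2 * ((dirDist Ω w x)⁻¹ + (dirDelta Ω w x)⁻¹) ^ α ≤
      lineEnergy α Ω f w := by
  obtain ⟨m, L, -, hLw, -, hFub⟩ := exists_lintegral_fiber hw
  obtain ⟨hfs, hfc, hfΩ⟩ := hf
  have hfcont : Continuous f := hfs.continuous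
  rw [lineEnergy_eq_lintegral_energy hFub hΩ.measurableSet hfcont.measurable,
    ← lintegral_indicator hΩ.measurableSet, hFub _ (by
      have := (measurable_dirWeight hΩ α).comp (measurable_prodMk_left (x := w))
      exact Measurable.indicator ((hfcont.measurable.enorm.pow_const 2).mul this)
        hΩ.measurableSet), ← lintegral_const_mul' _ _ ENNReal.ofReal_ne_top]
  refine lintegral_mono fun z ↦ ?_
  have hiso : Isometry fun s : ℝ ↦ L z + s • w := by
    refine Isometry.of_dist_eq fun s t ↦ ?_
    rw [dist_add_left, dist_eq_norm, ← sub_smul, norm_smul, hw, mul_one, Real.dist_eq,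
      Real.norm_eq_abs]
  have hJ : IsOpen {s : ℝ | L z + s • w ∈ Ω} := hΩ.preimage hiso.continuous
  refine le_trans (le_of_eq ?_) (open_hardy hα1 hα2 hJ (hfcont.comp hiso.continuous)
    (hfc.comp_isClosedEmbedding hiso.isClosedEmbedding)
    ((tsupport_comp_subset_preimage f hiso.continuous).trans (preimage_mono hfΩ)))
  congr 1
  rw [← lintegral_indicator hJ.measurableSet]
  refine lintegral_congr fun s ↦ ?_
  simp only [indicator, mem_ofPred_eq, dirDist, dirDelta, lineDist, lineDelta, add_smul, add_assoc]

theorem weightM_eq [NeZero n] (hα : 0 < α) (x : E n) :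
    weightM α Ω x = (∫⁻ w : sphere (0 : E n) 1,
      ((dirDist Ω (w : E n) x)⁻¹ + (dirDelta Ω (w : E n) x)⁻¹) ^ α
        ∂(volume : Measure (E n)).toSphere) / ENNReal.ofReal (sphereConst n α) := by
  set i : Fin n := ⟨n - 1, Nat.sub_one_lt (NeZero.ne n)⟩
  have h := sphereMoment_eq (ν := EuclideanSpace.single i (1 : ℝ)) hα (by simp)
  have hin : ∀ w : E n, inner ℝ (EuclideanSpace.single i (1 : ℝ)) w = w i := fun w ↦ by
    simp [EuclideanSpace.inner_single_left]
  rw [weightM, ← h, sphereMoment]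
  simp only [hin]
  rfl

theorem hardyInequality_weightM [NeZero n] (hα1 : 1 < α) (hα2 : α < 2) (hΩ : IsOpen Ω) :
    HardyInequality 𝕜 α Ω (weightM α Ω) (kappa n α) := by
  intro f hf
  have hα0 : 0 < α := by linarith
  have hS := sphereConst_pos (n := n) hα0
  have hfm : Measurable f := hf.1.continuous.measurable
  set S := ENNReal.ofReal (sphereConst n α) with hSdef
  have hS0 : S ≠ 0 := by simpa [S] using hS
  have hST : S ≠ ⊤ := ENNReal.ofReal_ne_top
  have hkey : ENNReal.ofReal (kappa 1 α) * (∫⁻ w : sphere (0 : E n) 1, (∫⁻ x in Ω,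
      ‖f x‖ₑ ^ 2 * ((dirDist Ω (w : E n) x)⁻¹ + (dirDelta Ω (w : E n) x)⁻¹) ^ α)
      ∂(volume : Measure (E n)).toSphere) ≤ gagliardo α Ω f := by
    rw [gagliardo_eq_lintegral_lineEnergy hΩ.measurableSet hfm,
      ← lintegral_const_mul' _ _ ENNReal.ofReal_ne_top]
    exact lintegral_mono fun w ↦ lineEnergy_hardy hα1 hα2 hΩ hf (norm_eq_of_mem_sphere w)
  have hswap : ∫⁻ x in Ω, ‖f x‖ₑ ^ 2 * weightM α Ω x = (∫⁻ w : sphere (0 : E n) 1, (∫⁻ x in Ω,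
      ‖f x‖ₑ ^ 2 * ((dirDist Ω (w : E n) x)⁻¹ + (dirDelta Ω (w : E n) x)⁻¹) ^ α)
      ∂(volume : Measure (E n)).toSphere) / S := by
    rw [lintegral_lintegral_swap, div_eq_mul_inv, ← lintegral_mul_const' _ _
      (ENNReal.inv_ne_top.2 hS0)]
    · refine lintegral_congr fun x ↦ ?_
      rw [weightM_eq hα0, lintegral_const_mul' _ _ (by simp), div_eq_mul_inv, mul_assoc]
    · have h := (measurable_dirWeight hΩ α).comp
        (by fun_prop : Measurable fun q : sphere (0 : E n) 1 × E n ↦ ((q.1 : E n), q.2))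
      exact (((hfm.comp measurable_snd).enorm.pow_const 2).mul h).aemeasurable
  rw [hswap, kappa_eq_mul_sphereConst hα0, ENNReal.ofReal_mul (kappa_one_pos hα1 hα2).le,
    ENNReal.ofReal_div_of_pos two_pos, ← hSdef, ENNReal.ofReal_ofNat]
  refine le_trans (le_of_eq ?_) (mul_le_mul_right hkey (1 / 2))
  set X := ∫⁻ w : sphere (0 : E n) 1, (∫⁻ x in Ω,
      ‖f x‖ₑ ^ 2 * ((dirDist Ω (w : E n) x)⁻¹ + (dirDelta Ω (w : E n) x)⁻¹) ^ α)
      ∂(volume : Measure (E n)).toSphere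
  calc ENNReal.ofReal (kappa 1 α) * (S / 2) * (X / S)
      = (S * S⁻¹) * (1 / 2 * (ENNReal.ofReal (kappa 1 α) * X)) := by
        simp only [div_eq_mul_inv, one_mul]; ring
    _ = _ := by rw [ENNReal.mul_inv_cancel hS0 hST, one_mul]

end GeneralDomain


section Convex

variable {n : ℕ} {α : ℝ} {Ω : Set (E n)}

theorem bdryDist_le_edist {x y : E n} (hx : x ∈ Ω) (hy : y ∉ Ω) : bdryDist Ω x ≤ edist x y := by
  obtain ⟨z, hz, hzf⟩ : (segment ℝ x y ∩ frontier Ω).Nonempty := by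
    by_contra hne
    have hcov : ∀ z ∈ segment ℝ x y, z ∈ interior Ω ∨ z ∉ closure Ω := fun z hz ↦ by
      by_contra! h
      exact hne ⟨z, hz, h.2, h.1⟩
    obtain ⟨z, -, hz1, hz2⟩ := (convex_segment x y).isPreconnected (interior Ω) (closure Ω)ᶜ
      isOpen_interior isClosed_closure.isOpen_compl hcov
      ⟨x, left_mem_segment ℝ x y, (hcov x (left_mem_segment ℝ x y)).resolve_right
        fun h ↦ h (subset_closure hx)⟩
      ⟨y, right_mem_segment ℝ x y, (hcov y (right_mem_segment ℝ x y)).resolve_left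
        fun h ↦ hy (interior_subset h)⟩
    exact hz2 (subset_closure (interior_subset hz1))
  refine (infEDist_le_edist_of_mem hzf).trans ?_
  rw [edist_dist, edist_dist]
  refine ENNReal.ofReal_le_ofReal ?_
  rw [← dist_add_dist_of_mem_segment hz]
  linarith [dist_nonneg (x := z) (y := y)]

theorem exists_mem_closestBdryPoints (hb : (frontier Ω).Nonempty) (x : E n) :
    ∃ z, z ∈ closestBdryPoints Ω x := by
  obtain ⟨z, hz, hxz⟩ := isClosed_frontier.exists_infDist_eq_dist hb x
  refine ⟨z, hz, ?_⟩
  rw [bdryDist, edist_dist, ← hxz, infDist, ENNReal.ofReal_toReal (infEDist_ne_top hb)]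

theorem exists_mem_supportingNormals (hΩ : IsOpen Ω) (hc : Convex ℝ Ω) (hne : Ω.Nonempty)
    {z : E n} (hz : z ∉ Ω) : ∃ ν, ν ∈ supportingNormals Ω z := by
  obtain ⟨f, hf⟩ := geometric_hahn_banach_open_point hc hΩ hz
  set u := (InnerProductSpace.toDual ℝ (E n)).symm f with hu
  have hfu : ∀ y, inner ℝ u y = f y := fun y ↦ InnerProductSpace.toDual_symm_apply
  have hu0 : u ≠ 0 := by
    intro h
    obtain ⟨y, hy⟩ := hne
    have := hf y hy
    rw [← hfu, ← hfu, h, inner_zero_left, inner_zero_left] at this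
    exact this.false
  have hun : 0 < ‖u‖ := norm_pos_iff.2 hu0
  refine ⟨-(‖u‖⁻¹ • u), ?_, fun y hy ↦ ?_⟩
  · rw [norm_neg, norm_smul, norm_inv, norm_norm, inv_mul_cancel₀ hun.ne']
  · rw [inner_neg_left, inner_smul_left, inner_sub_right, hfu, hfu]
    have h1 := hf y hy
    have h2 : 0 < ‖u‖⁻¹ := inv_pos.2 hun
    simp only [conj_trivial]
    nlinarith

theorem inner_pos_of_mem_supportingNormals (hΩ : IsOpen Ω) {z ν : E n}
    (hν : ν ∈ supportingNormals Ω z) {y : E n} (hy : y ∈ Ω) : 0 < inner ℝ ν (y - z) := by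
  obtain ⟨ε, hε, hball⟩ := Metric.isOpen_iff.1 hΩ y hy
  have hmem : y - (ε / 2) • ν ∈ Ω := hball (by
    rw [mem_ball, dist_eq_norm, sub_sub_cancel_left, norm_neg, norm_smul, hν.1, mul_one,
      Real.norm_of_nonneg (by positivity)]
    linarith)
  have h := hν.2 _ hmem
  rw [sub_right_comm, inner_sub_right, inner_smul_right, real_inner_self_eq_norm_sq, hν.1] at h
  linarith

theorem ofReal_inner_le_slabWidth {z ν y : E n} (hy : y ∈ Ω) :
    ENNReal.ofReal (inner ℝ ν (y - z)) ≤ slabWidth Ω z ν :=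
  le_sInf fun _ hD ↦ (hD hy).2

theorem ball_subset_of_mem_closestBdryPoints {x z : E n} (hx : x ∈ Ω)
    (hz : z ∈ closestBdryPoints Ω x) : ball x (dist x z) ⊆ Ω := by
  intro y hy
  by_contra h
  have h1 := bdryDist_le_edist hx h
  rw [← hz.2, edist_dist, edist_dist, ENNReal.ofReal_le_ofReal_iff dist_nonneg, dist_comm x y] at h1
  exact (mem_ball.1 hy).not_ge h1

theorem inner_eq_dist_of_mem_supportingNormals {x z ν : E n} (hx : x ∈ Ω)
    (hz : z ∈ closestBdryPoints Ω x) (hν : ν ∈ supportingNormals Ω z) :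
    inner ℝ ν (x - z) = dist x z := by
  refine le_antisymm ?_ (le_of_forall_lt fun t ht ↦ ?_)
  · simpa [hν.1, dist_eq_norm] using real_inner_le_norm ν (x - z)
  · rcases lt_or_ge t 0 with h0 | h0
    · exact h0.trans_le (hν.2 x hx)
    obtain ⟨u, htu, hu⟩ := exists_between ht
    have hmem : x - u • ν ∈ Ω := ball_subset_of_mem_closestBdryPoints hx hz (by
      rw [mem_ball, dist_eq_norm, sub_sub_cancel_left, norm_neg, norm_smul, hν.1, mul_one,
        Real.norm_of_nonneg (h0.trans htu.le)]
      exact hu)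
    have h := hν.2 _ hmem
    rw [sub_right_comm, inner_sub_right, inner_smul_right, real_inner_self_eq_norm_sq, hν.1] at h
    linarith

theorem dirDist_neg (w x : E n) : dirDist Ω (-w) x = dirDist Ω w x := by
  refine (Equiv.neg ℝ).iInf_congr fun t ↦ ?_
  simp

theorem dirDelta_neg (w x : E n) : dirDelta Ω (-w) x = dirDelta Ω w x := by
  refine (Equiv.neg ℝ).iSup_congr fun t ↦ ?_
  simp

theorem dirWeight_ge_of_inner_pos (hΩ : IsOpen Ω) {x z ν w : E n} (hx : x ∈ Ω)
    (hν : ν ∈ supportingNormals Ω z) (hw : 0 < inner ℝ ν w) :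
    ENNReal.ofReal (inner ℝ ν w) * ((ENNReal.ofReal (inner ℝ ν (x - z)))⁻¹ +
      (slabWidth Ω z ν - ENNReal.ofReal (inner ℝ ν (x - z)))⁻¹) ≤
      (dirDist Ω w x)⁻¹ + (dirDelta Ω w x)⁻¹ := by
  set c := inner ℝ ν w with hc
  set d := inner ℝ ν (x - z) with hd
  have hd0 : 0 < d := inner_pos_of_mem_supportingNormals hΩ hν hx
  set D := slabWidth Ω z ν - ENNReal.ofReal d with hD
  have hc0 : ENNReal.ofReal c ≠ 0 := by simpa using hw
  have hcT : ENNReal.ofReal c ≠ ⊤ := ENNReal.ofReal_ne_top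
  have hin : ∀ t : ℝ, inner ℝ ν (x + t • w - z) = d + t * c := fun t ↦ by
    rw [add_sub_right_comm, inner_add_right, inner_smul_right]
  have hup : ∀ t : ℝ, 0 ≤ t → x + t • w ∈ Ω → ENNReal.ofReal t ≤ D / ENNReal.ofReal c := by
    intro t ht hmem
    rw [ENNReal.le_div_iff_mul_le (Or.inl hc0) (Or.inl hcT), ← ENNReal.ofReal_mul ht, hD]
    refine ENNReal.le_sub_of_add_le_right ENNReal.ofReal_ne_top ?_
    rw [← ENNReal.ofReal_add (by positivity) hd0.le, add_comm, ← hin]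
    exact ofReal_inner_le_slabWidth hmem
  have hdiv : ENNReal.ofReal (d / c) = ENNReal.ofReal d / ENNReal.ofReal c :=
    ENNReal.ofReal_div_of_pos hw
  have h1 : dirDist Ω w x ≤ ENNReal.ofReal d / ENNReal.ofReal c := by
    refine (iInf₂_le (-(d / c)) fun hmem ↦ ?_).trans_eq ?_
    · have := inner_pos_of_mem_supportingNormals hΩ hν hmem
      rw [hin, neg_mul, div_mul_cancel₀ _ hw.ne', add_neg_cancel] at this
      exact this.false
    · rw [abs_neg, abs_of_pos (by positivity), hdiv]
  have h2 : dirDist Ω w x ≤ D / ENNReal.ofReal c := by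
    by_contra! h
    obtain ⟨t, ht1, ht2⟩ := ENNReal.lt_iff_exists_nnreal_btwn.1 h
    have hmem : x + (t : ℝ) • w ∈ Ω := by
      by_contra hn
      have : dirDist Ω w x ≤ ENNReal.ofReal |(t : ℝ)| := iInf₂_le (t : ℝ) hn
      rw [abs_of_nonneg t.coe_nonneg, ENNReal.ofReal_coe_nnreal] at this
      exact (this.trans_lt ht2).false
    have := hup t t.2 hmem
    rw [ENNReal.ofReal_coe_nnreal] at this
    exact (this.trans_lt ht1).false
  have h3 : dirDelta Ω w x ≤ max (ENNReal.ofReal d / ENNReal.ofReal c) (D / ENNReal.ofReal c) := by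
    refine iSup₂_le fun t ht ↦ ?_
    rcases le_total 0 t with h0 | h0
    · rw [abs_of_nonneg h0]
      exact le_max_of_le_right (hup t h0 ht)
    · rw [abs_of_nonpos h0, ← hdiv]
      refine le_max_of_le_left (ENNReal.ofReal_le_ofReal ?_)
      have := inner_pos_of_mem_supportingNormals hΩ hν ht
      rw [hin] at this
      rw [le_div_iff₀ hw]
      linarith
  have hinv : ∀ X : ℝ≥0∞, (X / ENNReal.ofReal c)⁻¹ = ENNReal.ofReal c * X⁻¹ := fun X ↦ by
    rw [ENNReal.inv_div (Or.inl hcT) (Or.inl hc0), div_eq_mul_inv]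
  rw [mul_add, ← hinv, ← hinv]
  refine le_trans (le_of_eq ?_)
    (add_le_add (ENNReal.inv_le_inv.2 (le_min h1 h2)) (ENNReal.inv_le_inv.2 h3))
  rcases le_total (ENNReal.ofReal d / ENNReal.ofReal c) (D / ENNReal.ofReal c) with h | h
  · rw [min_eq_left h, max_eq_right h]
  · rw [min_eq_right h, max_eq_left h, add_comm]

theorem dirWeight_ge (hΩ : IsOpen Ω) {x z ν : E n} (hx : x ∈ Ω)
    (hν : ν ∈ supportingNormals Ω z) (w : E n) :
    ENNReal.ofReal |inner ℝ ν w| * ((ENNReal.ofReal (inner ℝ ν (x - z)))⁻¹ +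
      (slabWidth Ω z ν - ENNReal.ofReal (inner ℝ ν (x - z)))⁻¹) ≤
      (dirDist Ω w x)⁻¹ + (dirDelta Ω w x)⁻¹ := by
  rcases lt_trichotomy (inner ℝ ν w) 0 with h | h | h
  · have := dirWeight_ge_of_inner_pos hΩ hx hν (w := -w) (by rw [inner_neg_right]; linarith)
    rwa [inner_neg_right, dirDist_neg, dirDelta_neg, ← abs_of_neg h] at this
  · simp [h]
  · rw [abs_of_pos h]
    exact dirWeight_ge_of_inner_pos hΩ hx hν h

theorem rpow_le_weightM [NeZero n] (hα : 0 < α) (hΩ : IsOpen Ω) {x z ν : E n} (hx : x ∈ Ω)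
    (hz : z ∈ closestBdryPoints Ω x) (hν : ν ∈ supportingNormals Ω z) :
    ((bdryDist Ω x)⁻¹ + (slabWidth Ω z ν - bdryDist Ω x)⁻¹) ^ α ≤ weightM α Ω x := by
  have hd : bdryDist Ω x = ENNReal.ofReal (inner ℝ ν (x - z)) := by
    rw [inner_eq_dist_of_mem_supportingNormals hx hz hν, ← hz.2, edist_dist]
  have hS := sphereMoment_eq hα hν.1
  have hS0 : sphereMoment α ν ≠ 0 := by
    rw [hS]; simpa using sphereConst_pos hα
  rw [weightM_eq hα, ← hS, hd, ENNReal.le_div_iff_mul_le (Or.inl hS0)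
    (Or.inl (by rw [hS]; exact ENNReal.ofReal_ne_top)), sphereMoment,
    ← lintegral_const_mul _ (by fun_prop)]
  refine lintegral_mono fun w ↦ ?_
  dsimp only
  rw [← ENNReal.mul_rpow_of_nonneg _ _ hα.le, mul_comm]
  exact ENNReal.rpow_le_rpow (dirWeight_ge hΩ hx hν _) hα.le

theorem weightD_le_weightM [NeZero n] (hα : 0 < α) (hΩ : IsOpen Ω) (hc : Convex ℝ Ω)
    (hb : (frontier Ω).Nonempty) {x : E n} (hx : x ∈ Ω) : weightD α Ω x ≤ weightM α Ω x := by
  set d := bdryDist Ω x with hd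
  set M := weightM α Ω x ^ α⁻¹ with hM
  have key : ∀ z ∈ closestBdryPoints Ω x, ∀ ν ∈ supportingNormals Ω z,
      d⁻¹ + (slabWidth Ω z ν - d)⁻¹ ≤ M ∧ d ≠ 0 ∧ d ≤ slabWidth Ω z ν := by
    intro z hz ν hν
    have hd' : d = ENNReal.ofReal (inner ℝ ν (x - z)) := by
      rw [inner_eq_dist_of_mem_supportingNormals hx hz hν, hd, ← hz.2, edist_dist]
    refine ⟨?_, ?_, ?_⟩
    · have := ENNReal.rpow_le_rpow (rpow_le_weightM hα hΩ hx hz hν) (inv_pos.2 hα).le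
      rwa [ENNReal.rpow_rpow_inv hα.ne'] at this
    · rw [hd']
      simpa using inner_pos_of_mem_supportingNormals hΩ hν hx
    · rw [hd']
      exact ofReal_inner_le_slabWidth hx
  obtain ⟨z₀, hz₀⟩ := exists_mem_closestBdryPoints hb x
  obtain ⟨ν₀, hν₀⟩ := exists_mem_supportingNormals hΩ hc ⟨x, hx⟩
    (fun h ↦ (hΩ.frontier_eq ▸ hz₀.1).2 h)
  have hd0 : d ≠ 0 := (key z₀ hz₀ ν₀ hν₀).2.1
  have hdM : d⁻¹ ≤ M := le_self_add.trans (key z₀ hz₀ ν₀ hν₀).1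
  have hdi : d⁻¹ ≠ ⊤ := ENNReal.inv_ne_top.2 hd0
  have hdT : d ≠ ⊤ := infEDist_ne_top hb
  have hw : (M - d⁻¹)⁻¹ + d ≤ widthAt Ω x := by
    refine le_iInf₂ fun z hz ↦ le_iInf₂ fun ν hν ↦ ?_
    obtain ⟨h1, -, h3⟩ := key z hz ν hν
    refine le_trans ?_ (tsub_add_cancel_of_le h3).le
    gcongr
    rw [← ENNReal.inv_le_inv, inv_inv]
    exact ENNReal.le_sub_of_add_le_left hdi h1
  have hw' : (widthAt Ω x - d)⁻¹ ≤ M - d⁻¹ := by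
    rw [← inv_inv (M - d⁻¹), ENNReal.inv_le_inv]
    exact ENNReal.le_sub_of_add_le_right hdT hw
  have hfin : d⁻¹ + (widthAt Ω x - d)⁻¹ ≤ M :=
    (add_le_add_right hw' _).trans_eq (add_tsub_cancel_of_le hdM)
  refine (ENNReal.rpow_le_rpow hfin hα.le).trans_eq ?_
  rw [hM, ENNReal.rpow_inv_rpow hα.ne']

theorem weightd_le_weightD (hα : 0 < α) (x : E n) : weightd α Ω x ≤ weightD α Ω x := by
  rw [weightd, weightD, ← ENNReal.inv_rpow]
  exact ENNReal.rpow_le_rpow le_self_add hα.le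

theorem HardyInequality.mono {𝕜 : Type*} [RCLike 𝕜] {C : ℝ} {W W' : E n → ℝ≥0∞}
    (hΩ : MeasurableSet Ω) (h : ∀ x ∈ Ω, W x ≤ W' x) (hH : HardyInequality 𝕜 α Ω W' C) :
    HardyInequality 𝕜 α Ω W C := by
  intro f hf
  refine le_trans ?_ (hH f hf)
  gcongr ENNReal.ofReal C * ?_
  exact setLIntegral_mono' hΩ fun x hx ↦ by gcongr; exact h x hx

end Convex


section Increment

variable {α : ℝ}

theorem lintegral_Ioi_comp_mul {c : ℝ} (hc : 0 < c) (h : ℝ → ℝ≥0∞) :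
    ∫⁻ r in Ioi (0 : ℝ), h (r * c) = ENNReal.ofReal c⁻¹ * ∫⁻ r in Ioi (0 : ℝ), h r := by
  have himg : (fun r : ℝ ↦ r * c⁻¹) '' Ioi 0 = Ioi 0 := by
    ext r
    simp only [mem_image, mem_Ioi]
    exact ⟨fun ⟨t, ht, h⟩ ↦ h ▸ mul_pos ht (inv_pos.2 hc),
      fun hr ↦ ⟨r * c, mul_pos hr hc, mul_inv_cancel_right₀ hc.ne' r⟩⟩
  conv_lhs => rw [← himg]
  rw [lintegral_image_eq_lintegral_abs_deriv_mul (f' := fun _ ↦ c⁻¹) measurableSet_Ioi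
    (fun r _ ↦ by simpa using ((hasDerivAt_id r).mul_const c⁻¹).hasDerivWithinAt)
    (mul_left_injective₀ (inv_pos.2 hc).ne').injOn, abs_of_pos (inv_pos.2 hc),
    ← lintegral_const_mul' _ _ ENNReal.ofReal_ne_top]
  refine lintegral_congr fun r ↦ ?_
  rw [inv_mul_cancel_right₀ hc.ne']

theorem lintegral_Ioi_rpow_mul_comp_mul (hα : 0 < α) {c : ℝ} (hc : 0 < c) (h : ℝ → ℝ≥0∞) :
    ∫⁻ r in Ioi (0 : ℝ), ENNReal.ofReal (c ^ (1 + α)) * h (r * c) =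
      ENNReal.ofReal (c ^ α) * ∫⁻ r in Ioi (0 : ℝ), h r := by
  rw [lintegral_const_mul' _ _ ENNReal.ofReal_ne_top, lintegral_Ioi_comp_mul hc, ← mul_assoc,
    ← ENNReal.ofReal_mul (by positivity), Real.rpow_one_add' hc.le (by positivity)]
  congr 2
  field_simp

theorem increment_of_pos (hα : 0 < α) {J : Set ℝ} (g : ℝ → ℝ) {c : ℝ} (hc : 0 < c) :
    increment α J g c = ENNReal.ofReal c ^ α * increment α J g 1 := by
  have hcT : ENNReal.ofReal c ^ α ≠ ⊤ := by
    rw [ENNReal.ofReal_rpow_of_pos hc]; exact ENNReal.ofReal_ne_top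
  rw [increment, increment, ← lintegral_const_mul' _ _ hcT]
  refine lintegral_congr fun s ↦ ?_
  have h := lintegral_Ioi_rpow_mul_comp_mul hα hc fun r ↦
    (J.indicator 1 s * J.indicator 1 (s + r) *
    (‖g s - g (s + r)‖ₑ ^ 2 / ENNReal.ofReal r ^ (1 + α)))
  simp only [mul_one]
  rw [ENNReal.ofReal_rpow_of_pos hc, ← h]
  refine setLIntegral_congr_fun measurableSet_Ioi fun r hr ↦ ?_
  have hr : 0 < r := hr
  rw [ENNReal.ofReal_rpow_of_pos hr,
    ENNReal.ofReal_rpow_of_pos (by positivity), Real.mul_rpow hr.le hc.le,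
    ENNReal.ofReal_mul (by positivity), mul_left_comm]
  congr 1
  have h1 : ENNReal.ofReal (c ^ (1 + α)) ≠ 0 := by
    simp only [ne_eq, ENNReal.ofReal_eq_zero, not_le]; positivity
  rw [mul_comm (ENNReal.ofReal (r ^ (1 + α))), ← mul_div_assoc,
    ENNReal.mul_div_mul_left _ _ h1 ENNReal.ofReal_ne_top]

theorem measurable_increment_integrand {J : Set ℝ} (hJ : MeasurableSet J) {g : ℝ → ℝ}
    (hg : Measurable g) (c : ℝ) :
    Measurable fun q : ℝ × ℝ ↦ (J.indicator 1 q.1 * J.indicator 1 (q.1 + q.2 * c) *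
      (‖g q.1 - g (q.1 + q.2 * c)‖ₑ ^ 2 / ENNReal.ofReal q.2 ^ (1 + α)) : ℝ≥0∞) := by
  have hi : Measurable (J.indicator (1 : ℝ → ℝ≥0∞)) := measurable_one.indicator hJ
  fun_prop

theorem increment_neg {J : Set ℝ} (hJ : MeasurableSet J) {g : ℝ → ℝ} (hg : Measurable g) (c : ℝ) :
    increment α J g (-c) = increment α J g c := by
  have hsw : ∀ c, increment α J g c = ∫⁻ r in Ioi (0 : ℝ), ∫⁻ s, J.indicator 1 s *
      J.indicator 1 (s + r * c) * (‖g s - g (s + r * c)‖ₑ ^ 2 / ENNReal.ofReal r ^ (1 + α)) :=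
    fun c ↦ lintegral_lintegral_swap (measurable_increment_integrand hJ hg c).aemeasurable
  rw [hsw, hsw]
  refine lintegral_congr fun r ↦ ?_
  rw [← lintegral_add_right_eq_self (μ := volume) _ (r * c)]
  refine lintegral_congr fun s ↦ ?_
  rw [mul_neg, add_neg_cancel_right, mul_comm (J.indicator 1 s), ← enorm_neg, neg_sub]

theorem increment_eq (hα : 0 < α) {J : Set ℝ} (hJ : MeasurableSet J) {g : ℝ → ℝ}
    (hg : Measurable g) (c : ℝ) :
    increment α J g c = ENNReal.ofReal |c| ^ α * energy α J g := by
  rw [energy_eq_increment hJ]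
  rcases lt_trichotomy c 0 with h | rfl | h
  · rw [abs_of_neg h, ← increment_of_pos hα g (neg_pos.2 h), increment_neg hJ hg]
  · simp [increment, ENNReal.zero_rpow_of_pos hα]
  · rw [abs_of_pos h, increment_of_pos hα g h]

/-- The constant `∫₀^∞ min (1, r²) r ^ (-(1 + α)) dr`. -/
def tailConst (α : ℝ) : ℝ≥0∞ :=
  ∫⁻ r in Ioi (0 : ℝ), ENNReal.ofReal (min 1 (r ^ 2)) / ENNReal.ofReal r ^ (1 + α)

theorem tailConst_ne_top (hα0 : 0 < α) (hα2 : α < 2) : tailConst α ≠ ⊤ := by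
  have hpt : ∀ r : ℝ, 0 < r → ENNReal.ofReal (min 1 (r ^ 2)) / ENNReal.ofReal r ^ (1 + α) =
      ENNReal.ofReal (min 1 (r ^ 2) * r ^ (-(1 + α))) := fun r hr ↦ by
    rw [ENNReal.ofReal_rpow_of_pos hr, ← ENNReal.ofReal_div_of_pos (by positivity),
      Real.rpow_neg hr.le, div_eq_mul_inv]
  have h1 : ∫⁻ r in Ioc (0 : ℝ) 1,
      ENNReal.ofReal (min 1 (r ^ 2)) / ENNReal.ofReal r ^ (1 + α) ≠ ⊤ := by
    have hint : IntegrableOn (fun r : ℝ ↦ r ^ (1 - α)) (Ioc 0 1) :=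
      (intervalIntegrable_iff_integrableOn_Ioc_of_le zero_le_one).1
        (intervalIntegral.intervalIntegrable_rpow' (by linarith))
    refine ne_top_of_le_ne_top hint.lintegral_lt_top.ne
      (setLIntegral_mono' measurableSet_Ioc fun r hr ↦ ?_)
    rw [hpt r hr.1]
    refine ENNReal.ofReal_le_ofReal ?_
    calc min 1 (r ^ 2) * r ^ (-(1 + α)) ≤ r ^ 2 * r ^ (-(1 + α)) := by
          have := hr.1
          gcongr; exact min_le_right _ _
      _ = r ^ (1 - α) := by
          rw [← Real.rpow_natCast, ← Real.rpow_add hr.1]; congr 1; push_cast; ring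
  have h2 : ∫⁻ r in Ioi (1 : ℝ),
      ENNReal.ofReal (min 1 (r ^ 2)) / ENNReal.ofReal r ^ (1 + α) ≠ ⊤ := by
    have hint := integrableOn_Ioi_rpow_of_lt (a := -(1 + α)) (by linarith) one_pos
    refine ne_top_of_le_ne_top hint.lintegral_lt_top.ne
      (setLIntegral_mono' measurableSet_Ioi fun r hr ↦ ?_)
    have hr0 : 0 < r := zero_lt_one.trans hr
    rw [hpt r hr0]
    refine ENNReal.ofReal_le_ofReal ?_
    calc min 1 (r ^ 2) * r ^ (-(1 + α)) ≤ 1 * r ^ (-(1 + α)) := by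
          gcongr; exact min_le_left _ _
      _ = r ^ (-(1 + α)) := one_mul _
  rw [tailConst, ← Ioc_union_Ioi_eq_Ioi zero_le_one]
  exact ne_top_of_le_ne_top (ENNReal.add_ne_top.2 ⟨h1, h2⟩) (lintegral_union_le _ _ _)

theorem lintegral_tail_scale (hα : 0 < α) {R : ℝ} (hR : 0 < R) :
    ∫⁻ r in Ioi (0 : ℝ), ENNReal.ofReal (min 1 ((r * R⁻¹) ^ 2)) / ENNReal.ofReal r ^ (1 + α) =
      ENNReal.ofReal (R ^ (-α)) * tailConst α := by
  have hRi := inv_pos.2 hR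
  have h := lintegral_Ioi_rpow_mul_comp_mul hα hRi fun r ↦
    ENNReal.ofReal (min 1 (r ^ 2)) / ENNReal.ofReal r ^ (1 + α)
  rw [Real.inv_rpow hR.le, Real.inv_rpow hR.le, ← Real.rpow_neg hR.le α] at h
  rw [tailConst, ← h]
  refine setLIntegral_congr_fun measurableSet_Ioi fun r hr ↦ ?_
  have hr : 0 < r := hr
  have h1 : ENNReal.ofReal (R⁻¹ ^ (1 + α)) ≠ 0 := by
    simp only [ne_eq, ENNReal.ofReal_eq_zero, not_le]; positivity
  rw [← Real.inv_rpow hR.le, ENNReal.ofReal_rpow_of_pos hr,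
    ENNReal.ofReal_rpow_of_pos (by positivity), Real.mul_rpow hr.le hRi.le,
    ENNReal.ofReal_mul (by positivity), mul_comm (ENNReal.ofReal (r ^ (1 + α))), ← mul_div_assoc,
    ENNReal.mul_div_mul_left _ _ h1 ENNReal.ofReal_ne_top]

/-- The `L²` modulus of continuity of a Lipschitz function with compact support. -/
theorem exists_lintegral_sub_shift_le {V : Type*} [NormedAddCommGroup V] [NormedSpace ℝ V]
    [FiniteDimensional ℝ V] [MeasurableSpace V] [BorelSpace V] (μ : Measure V) [μ.IsAddHaarMeasure]
    {ψ : V → ℝ} (hψ : ContDiff ℝ 1 ψ) (hc : HasCompactSupport ψ) :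
    ∃ K : ℝ≥0∞, K ≠ ⊤ ∧ ∀ h : V, ∫⁻ z, ‖ψ z - ψ (z + h)‖ₑ ^ 2 ∂μ ≤
      K * ENNReal.ofReal (min 1 (‖h‖ ^ 2)) := by
  obtain ⟨Λ, hΛ⟩ := hψ.lipschitzWith_of_hasCompactSupport hc one_ne_zero
  obtain ⟨M, hM⟩ := hψ.continuous.bounded_above_of_compact_support hc
  set B := tsupport ψ
  have hB : MeasurableSet B := (isClosed_tsupport ψ).measurableSet
  set A : ℝ := 4 * M ^ 2 + Λ ^ 2
  have hpt : ∀ h z : V, ‖ψ z - ψ (z + h)‖ₑ ^ 2 ≤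
      ENNReal.ofReal (A * min 1 (‖h‖ ^ 2)) * (B.indicator 1 z + B.indicator 1 (z + h)) := by
    intro h z
    by_cases hz : z ∈ B ∨ z + h ∈ B
    · have h1 : (1 : ℝ≥0∞) ≤ B.indicator 1 z + B.indicator 1 (z + h) := by
        rcases hz with hz | hz
        · rw [indicator_of_mem hz]; exact le_self_add
        · rw [indicator_of_mem hz]; exact le_add_self
      refine le_trans ?_ (le_mul_of_one_le_right zero_le h1)
      rw [← ofReal_norm, ← ENNReal.ofReal_pow (norm_nonneg _)]
      refine ENNReal.ofReal_le_ofReal ?_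
      have h2 : ‖ψ z - ψ (z + h)‖ ≤ Λ * ‖h‖ := by
        have := hΛ.dist_le_mul z (z + h)
        simpa [dist_eq_norm] using this
      have h3 : ‖ψ z - ψ (z + h)‖ ≤ 2 * M := by
        linarith [norm_sub_le (ψ z) (ψ (z + h)), hM z, hM (z + h)]
      have h4 : ‖ψ z - ψ (z + h)‖ ^ 2 ≤ (Λ * ‖h‖) ^ 2 := by gcongr
      have h5 : ‖ψ z - ψ (z + h)‖ ^ 2 ≤ (2 * M) ^ 2 := by gcongr
      rcases le_total 1 (‖h‖ ^ 2) with hh | hh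
      · rw [min_eq_left hh]
        nlinarith [sq_nonneg (Λ : ℝ)]
      · rw [min_eq_right hh]
        nlinarith [mul_nonneg (sq_nonneg M) (sq_nonneg ‖h‖)]
    · push Not at hz
      rw [image_eq_zero_of_notMem_tsupport hz.1, image_eq_zero_of_notMem_tsupport hz.2]
      simp
  refine ⟨ENNReal.ofReal A * (2 * μ B), ENNReal.mul_ne_top ENNReal.ofReal_ne_top
    (ENNReal.mul_ne_top (by simp) hc.isCompact.measure_lt_top.ne), fun h ↦ ?_⟩
  refine (lintegral_mono (hpt h)).trans_eq ?_
  have hi : Measurable (B.indicator (1 : V → ℝ≥0∞)) := measurable_one.indicator hB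
  rw [lintegral_const_mul' _ _ ENNReal.ofReal_ne_top, lintegral_add_left hi,
    lintegral_add_right_eq_self (μ := μ) (fun z ↦ B.indicator 1 z) h, lintegral_indicator_one hB,
    ENNReal.ofReal_mul (by positivity), two_mul]
  ring

theorem lintegral_comp_scale {V : Type*} [NormedAddCommGroup V] [NormedSpace ℝ V]
    [FiniteDimensional ℝ V] [MeasurableSpace V] [BorelSpace V] (μ : Measure V) [μ.IsAddHaarMeasure]
    {R : ℝ} (hR : 0 < R) (z : V) (F : V → ℝ≥0∞) :
    ∫⁻ x, F (R⁻¹ • (x - z)) ∂μ = ENNReal.ofReal (R ^ Module.finrank ℝ V) * ∫⁻ x, F x ∂μ := by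
  rw [lintegral_sub_right_eq_self (μ := μ) (fun x ↦ F (R⁻¹ • x)) z]
  have h := (measurableEmbedding_const_smul₀ (α := V) (inv_pos.2 hR).ne').lintegral_map F
    (μ := μ)
  rw [← h, Measure.map_addHaar_smul _ (inv_pos.2 hR).ne', lintegral_smul_measure,
    inv_pow, inv_inv, abs_of_pos (by positivity), smul_eq_mul]

theorem lintegral_enorm_sq_ne_top {V : Type*} [TopologicalSpace V] [MeasurableSpace V]
    [OpensMeasurableSpace V] (μ : Measure V) [IsFiniteMeasureOnCompacts μ] {χ : V → ℝ}
    (hχ : Continuous χ) (hc : HasCompactSupport χ) : ∫⁻ x, ‖χ x‖ₑ ^ 2 ∂μ ≠ ⊤ := by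
  have hc2 : HasCompactSupport fun x ↦ χ x ^ 2 := hc.comp_left (g := fun t : ℝ ↦ t ^ 2) (by simp)
  have hint : Integrable (fun x ↦ χ x ^ 2) μ := (hχ.pow 2).integrable_of_hasCompactSupport hc2
  simpa only [HasFiniteIntegral, enorm_pow] using hint.2.ne

theorem exists_contDiff_lintegral_sq {V : Type*} [NormedAddCommGroup V] [NormedSpace ℝ V]
    [FiniteDimensional ℝ V] [MeasurableSpace V] [BorelSpace V] (μ : Measure V)
    [μ.IsAddHaarMeasure] :
    ∃ χ : V → ℝ, ContDiff ℝ ∞ χ ∧ Function.support χ ⊆ closedBall 0 1 ∧ HasCompactSupport χ ∧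
      ∫⁻ x, ‖χ x‖ₑ ^ 2 ∂μ ≠ 0 ∧ ∫⁻ x, ‖χ x‖ₑ ^ 2 ∂μ ≠ ⊤ := by
  obtain ⟨χ, hχs, hχ, -⟩ :=
    (isOpen_ball (x := (0 : V)) (ε := 1)).exists_contDiff_support_eq (n := ⊤)
  have hsub := hχs.trans_subset ball_subset_closedBall
  have hc := HasCompactSupport.of_support_subset_isCompact (isCompact_closedBall 0 1) hsub
  refine ⟨χ, hχ, hsub, hc, ?_, lintegral_enorm_sq_ne_top μ hχ.continuous hc⟩
  have hm := hχ.continuous.measurable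
  rw [← pos_iff_ne_zero, lintegral_pos_iff_support (by fun_prop)]
  refine (measure_ball_pos μ (0 : V) one_pos).trans_le (measure_mono fun s hs ↦ ?_)
  rw [← hχs] at hs
  simpa using hs

end Increment


section LogTest

variable {α p R : ℝ} {χ : ℝ → ℝ}

/-- The function `x ^ p * χ (log x / R)` on the positive half-line, extended by zero. -/
def logTest (p : ℝ) (χ : ℝ → ℝ) (R x : ℝ) : ℝ :=
  if 0 < x then x ^ p * χ (R⁻¹ * Real.log x) else 0

theorem logTest_exp (p : ℝ) (χ : ℝ → ℝ) (R s : ℝ) :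
    logTest p χ R (Real.exp s) = Real.exp (p * s) * χ (R⁻¹ • s) := by
  rw [logTest, if_pos (Real.exp_pos s), Real.log_exp, ← Real.exp_mul, mul_comm s, smul_eq_mul]

theorem support_logTest_subset (hR : 0 < R) {b : ℝ} (hχ : Function.support χ ⊆ Icc (-b) b) :
    Function.support (logTest p χ R) ⊆ Icc (Real.exp (-(R * b))) (Real.exp (R * b)) := by
  intro x hx
  rw [Function.mem_support, logTest] at hx
  split_ifs at hx with h
  · have h1 : R⁻¹ * Real.log x ∈ Icc (-b) b := hχ (right_ne_zero_of_mul hx)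
    have h2 : R * (R⁻¹ * Real.log x) = Real.log x := mul_inv_cancel_left₀ hR.ne' _
    rw [mem_Icc, ← Real.le_log_iff_exp_le h, ← Real.log_le_iff_le_exp h, ← h2]
    constructor <;> nlinarith [h1.1, h1.2]
  · exact absurd rfl hx

theorem tsupport_logTest_subset (hR : 0 < R) {b : ℝ} (hχ : Function.support χ ⊆ Icc (-b) b) :
    tsupport (logTest p χ R) ⊆ Icc (Real.exp (-(R * b))) (Real.exp (R * b)) :=
  closure_minimal (support_logTest_subset hR hχ) isClosed_Icc

theorem contDiff_logTest (hR : 0 < R) {b : ℝ} (hχ : Function.support χ ⊆ Icc (-b) b)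
    (hs : ContDiff ℝ ∞ χ) : ContDiff ℝ ∞ (logTest p χ R) := by
  rw [contDiff_iff_contDiffAt]
  intro x
  rcases lt_or_ge 0 x with hx | hx
  · have h1 : ContDiffAt ℝ ∞ (fun x : ℝ ↦ x ^ p * χ (R⁻¹ * Real.log x)) x :=
      (contDiffAt_id.rpow_const_of_ne hx.ne').mul
        (hs.contDiffAt.comp x (contDiffAt_const.mul (Real.contDiffAt_log.2 hx.ne')))
    refine h1.congr_of_eventuallyEq ?_
    filter_upwards [lt_mem_nhds hx] with y hy
    rw [logTest, if_pos hy]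
  · refine (contDiffAt_const (c := (0 : ℝ))).congr_of_eventuallyEq ?_
    filter_upwards [gt_mem_nhds (hx.trans_lt (Real.exp_pos (-(R * b))))] with y hy
    by_contra h
    exact hy.not_ge (support_logTest_subset hR hχ h).1

theorem exp_sub_exp_eq (s t : ℝ) : Real.exp t - Real.exp s =
    2 * Real.sinh ((t - s) / 2) / √(Real.exp (-s) * Real.exp (-t)) := by
  rw [← Real.exp_add, show -s + -t = -((s + t) / 2) + -((s + t) / 2) by ring, Real.exp_add,
    Real.sqrt_mul_self (Real.exp_pos _).le, Real.exp_neg, div_inv_eq_mul, Real.sinh_eq,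
    mul_div_cancel₀ _ two_ne_zero, sub_mul, ← Real.exp_add, ← Real.exp_add]
  congr 2 <;> ring

theorem hasDerivAt_exp_inv (s : ℝ) : HasDerivAt Real.exp (Real.exp (-s))⁻¹ s := by
  rw [Real.exp_neg, inv_inv]; exact Real.hasDerivAt_exp s

theorem lintegral_logTest (hR : 0 < R) :
    ∫⁻ x in Ioi (0 : ℝ), ‖logTest ((α - 1) / 2) χ R x‖ₑ ^ 2 * (ENNReal.ofReal x ^ α)⁻¹ =
      ENNReal.ofReal R * ∫⁻ s, ‖χ s‖ₑ ^ 2 := by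
  rw [← Real.range_exp, lintegral_range_weight_eq (ρ := fun s ↦ Real.exp (-s))
    (fun s ↦ Real.exp_pos _) hasDerivAt_exp_inv fun s ↦ by
      rw [Real.exp_neg, ENNReal.ofReal_inv_of_pos (Real.exp_pos s), ENNReal.inv_rpow]]
  have h := lintegral_comp_scale volume hR (0 : ℝ) fun s ↦ ‖χ s‖ₑ ^ 2
  simp only [Module.finrank_self, pow_one, sub_zero] at h
  rw [← h]
  refine lintegral_congr fun s ↦ ?_
  rw [logTest_exp, enorm_mul, mul_pow, ← mul_assoc, Real.enorm_eq_ofReal (Real.exp_pos _).le,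
    ← ENNReal.ofReal_pow (Real.exp_pos _).le, ← ENNReal.ofReal_mul (by positivity), ← Real.exp_mul,
    ← Real.exp_nat_mul, ← Real.exp_add]
  rw [show -s * (α - 1) + (2 : ℕ) * ((α - 1) / 2 * s) = 0 by push_cast; ring]
  simp

theorem logKernel_le (hα : 0 < α) {r : ℝ} (hr : 0 < r) :
    ENNReal.ofReal (logKernel α r) ≤ (ENNReal.ofReal r ^ (1 + α))⁻¹ := by
  rw [ENNReal.ofReal_rpow_of_pos hr, ← ENNReal.ofReal_inv_of_pos (by positivity), logKernel,
    Real.rpow_neg (by have := Real.sinh_pos_iff.2 (half_pos hr); positivity)]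
  have h : r ≤ 2 * Real.sinh (r / 2) := by
    have := Real.self_le_sinh_iff.2 (half_pos hr).le
    linarith
  gcongr

/-- The ground state representation of the increments of `exp (p s) ψ (s)`. -/
theorem lintegral_increment_eq {ψ : ℝ → ℝ} (hψ : Measurable ψ)
    (hfin : ∫⁻ s, ‖ψ s‖ₑ ^ 2 ≠ ⊤) (r : ℝ) :
    ∫⁻ s, ENNReal.ofReal ((Real.exp (-s) * Real.exp (-(s + r))) ^ p) *
        ‖Real.exp (p * s) * ψ s - Real.exp (p * (s + r)) * ψ (s + r)‖ₑ ^ 2 =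
      (∫⁻ s, ‖ψ s - ψ (s + r)‖ₑ ^ 2) +
        ENNReal.ofReal (Real.exp (p * r) + Real.exp (-(p * r)) - 2) * ∫⁻ s, ‖ψ s‖ₑ ^ 2 := by
  set N := ∫⁻ s, ‖ψ s‖ₑ ^ 2 with hN
  have hN' : ∫⁻ s, ‖ψ (s + r)‖ₑ ^ 2 = N :=
    lintegral_add_right_eq_self (μ := volume) (fun s ↦ ‖ψ s‖ₑ ^ 2) r
  have hsq : ∀ x : ℝ, ‖x‖ₑ ^ 2 = ENNReal.ofReal (x ^ 2) := fun x ↦ by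
    rw [← ofReal_norm, ← ENNReal.ofReal_pow (norm_nonneg _), Real.norm_eq_abs, sq_abs]
  have hpt : ∀ s, ENNReal.ofReal ((Real.exp (-s) * Real.exp (-(s + r))) ^ p) *
        ‖Real.exp (p * s) * ψ s - Real.exp (p * (s + r)) * ψ (s + r)‖ₑ ^ 2 +
      (‖ψ s‖ₑ ^ 2 + ‖ψ (s + r)‖ₑ ^ 2) = ‖ψ s - ψ (s + r)‖ₑ ^ 2 +
        (ENNReal.ofReal (Real.exp (-(p * r))) * ‖ψ s‖ₑ ^ 2 +
          ENNReal.ofReal (Real.exp (p * r)) * ‖ψ (s + r)‖ₑ ^ 2) := by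
    intro s
    have e1 : (Real.exp (-s) * Real.exp (-(s + r))) ^ p =
        (Real.exp (p * s))⁻¹ ^ 2 * (Real.exp (p * r))⁻¹ := by
      rw [← Real.exp_add, ← Real.exp_mul, ← Real.exp_neg, ← Real.exp_neg, ← Real.exp_nat_mul,
        ← Real.exp_add]
      congr 1; push_cast; ring
    have e2 : Real.exp (p * (s + r)) = Real.exp (p * s) * Real.exp (p * r) := by
      rw [← Real.exp_add]; congr 1; ring
    have h1 := Real.exp_pos (p * s)
    have h2 := Real.exp_pos (p * r)
    rw [e1, e2, Real.exp_neg]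
    simp only [hsq]
    rw [← ENNReal.ofReal_mul (by positivity), ← ENNReal.ofReal_mul (by positivity),
      ← ENNReal.ofReal_mul (by positivity), ← ENNReal.ofReal_add (by positivity) (by positivity),
      ← ENNReal.ofReal_add (by positivity) (by positivity),
      ← ENNReal.ofReal_add (by positivity) (by positivity),
      ← ENNReal.ofReal_add (by positivity) (by positivity)]
    congr 1
    field_simp
    ring
  have hint := lintegral_congr (μ := volume) hpt
  have hm1 : Measurable fun s ↦ ‖ψ s‖ₑ ^ 2 + ‖ψ (s + r)‖ₑ ^ 2 := by fun_prop
  have hm2 : Measurable fun s ↦ ‖ψ s‖ₑ ^ 2 := by fun_prop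
  have hm3 : Measurable fun s ↦ ‖ψ s - ψ (s + r)‖ₑ ^ 2 := by fun_prop
  have hm4 : Measurable fun s ↦ ENNReal.ofReal (Real.exp (-(p * r))) * ‖ψ s‖ₑ ^ 2 := by fun_prop
  rw [lintegral_add_right _ hm1, lintegral_add_left hm2, lintegral_add_left hm3,
    lintegral_add_left hm4, lintegral_const_mul' _ _ ENNReal.ofReal_ne_top,
    lintegral_const_mul' _ _ ENNReal.ofReal_ne_top, hN', ← hN, ← add_mul,
    ← ENNReal.ofReal_add (Real.exp_pos _).le (Real.exp_pos _).le] at hint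
  have hm : 2 ≤ Real.exp (p * r) + Real.exp (-(p * r)) := by
    have h := Real.one_le_cosh (p * r)
    rw [Real.cosh_eq] at h
    linarith
  have hsplit : ENNReal.ofReal (Real.exp (-(p * r)) + Real.exp (p * r)) * N =
      ENNReal.ofReal (Real.exp (p * r) + Real.exp (-(p * r)) - 2) * N + (N + N) := by
    rw [← two_mul, ← add_mul, ← ENNReal.ofReal_ofNat 2,
      ← ENNReal.ofReal_add (by linarith) zero_le_two]
    congr 2; ring
  rw [hsplit, ← add_assoc (∫⁻ s, ‖ψ s - ψ (s + r)‖ₑ ^ 2)] at hint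
  exact (ENNReal.add_left_inj (ENNReal.add_ne_top.2 ⟨hfin, hfin⟩)).1 hint

theorem energy_logTest_le (hα1 : 1 < α) (hα2 : α < 2) (hR : 0 < R) (hs : Measurable χ)
    (hfin : ∫⁻ s, ‖χ s‖ₑ ^ 2 ≠ ⊤) {K : ℝ≥0∞}
    (hK : ∀ h : ℝ, ∫⁻ z, ‖χ z - χ (z + h)‖ₑ ^ 2 ≤ K * ENNReal.ofReal (min 1 (‖h‖ ^ 2))) :
    energy α (Ioi 0) (logTest ((α - 1) / 2) χ R) ≤ ENNReal.ofReal R *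
      (ENNReal.ofReal (kappa 1 α) * (∫⁻ s, ‖χ s‖ₑ ^ 2) +
        K * (ENNReal.ofReal (R ^ (-α)) * tailConst α)) := by
  have hα0 : 0 < α := by linarith
  have hχm : Measurable fun s ↦ χ (R⁻¹ • s) := by fun_prop
  have hgm : Measurable (logTest ((α - 1) / 2) χ R) := by
    unfold logTest
    exact Measurable.ite measurableSet_Ioi (by fun_prop) measurable_const
  set N := ∫⁻ s, ‖χ s‖ₑ ^ 2
  have hscale : ∀ F : ℝ → ℝ≥0∞, ∫⁻ s, F (R⁻¹ • s) = ENNReal.ofReal R * ∫⁻ s, F s := fun F ↦ by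
    simpa using lintegral_comp_scale volume hR (0 : ℝ) F
  have hNR : ∫⁻ s, ‖χ (R⁻¹ • s)‖ₑ ^ 2 = ENNReal.ofReal R * N := hscale fun s ↦ ‖χ s‖ₑ ^ 2
  have hNRfin : ∫⁻ s, ‖χ (R⁻¹ • s)‖ₑ ^ 2 ≠ ⊤ := by
    rw [hNR]; exact ENNReal.mul_ne_top ENNReal.ofReal_ne_top hfin
  have hD : ∀ r : ℝ, ∫⁻ s, ‖χ (R⁻¹ • s) - χ (R⁻¹ • (s + r))‖ₑ ^ 2 ≤
      ENNReal.ofReal R * (K * ENNReal.ofReal (min 1 ((r * R⁻¹) ^ 2))) := fun r ↦ by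
    have h := hK (r * R⁻¹)
    rw [Real.norm_eq_abs, sq_abs] at h
    refine le_trans (le_of_eq ?_) (mul_le_mul_right h _)
    rw [← hscale fun z ↦ ‖χ z - χ (z + r * R⁻¹)‖ₑ ^ 2]
    simp only [smul_eq_mul, mul_add, mul_comm r]
  rw [← Real.range_exp, energy_range_eq (ρ := fun s ↦ Real.exp (-s)) (fun s ↦ Real.exp_pos _)
    (by fun_prop) hasDerivAt_exp_inv exp_sub_exp_eq hgm]
  simp only [logTest_exp, lintegral_increment_eq hχm hNRfin]
  calc ∫⁻ r in Ioi (0 : ℝ), ENNReal.ofReal (logKernel α r) *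
        ((∫⁻ s, ‖χ (R⁻¹ • s) - χ (R⁻¹ • (s + r))‖ₑ ^ 2) +
          ENNReal.ofReal (Real.exp ((α - 1) / 2 * r) + Real.exp (-((α - 1) / 2 * r)) - 2) *
            ∫⁻ s, ‖χ (R⁻¹ • s)‖ₑ ^ 2)
      ≤ ∫⁻ r in Ioi (0 : ℝ), (ENNReal.ofReal R * K *
          (ENNReal.ofReal (min 1 ((r * R⁻¹) ^ 2)) / ENNReal.ofReal r ^ (1 + α)) +
          ENNReal.ofReal ((Real.exp ((α - 1) / 2 * r) + Real.exp (-((α - 1) / 2 * r)) - 2) *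
            logKernel α r) * (ENNReal.ofReal R * N)) := by
        refine setLIntegral_mono' measurableSet_Ioi fun r hr ↦ ?_
        have hr : 0 < r := hr
        rw [mul_add, hNR, ENNReal.ofReal_mul' (logKernel_nonneg hr), ← mul_assoc,
          mul_comm (ENNReal.ofReal (logKernel α r)) (ENNReal.ofReal (_ - 2))]
        gcongr ?_ + _
        refine (mul_le_mul' (logKernel_le hα0 hr) (hD r)).trans_eq ?_
        rw [div_eq_mul_inv]; ring
    _ = _ := by
        have hm : Measurable fun r : ℝ ↦ ENNReal.ofReal R * K *
            (ENNReal.ofReal (min 1 ((r * R⁻¹) ^ 2)) / ENNReal.ofReal r ^ (1 + α)) := by fun_prop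
        rw [lintegral_add_left hm, lintegral_const_mul _ (by fun_prop), lintegral_tail_scale hα0 hR,
          lintegral_mul_const' _ _ (ENNReal.mul_ne_top ENNReal.ofReal_ne_top hfin),
          lintegral_logKernel hα1 hα2]
        ring

/-- Optimality of the one-dimensional constant on the half-line. -/
theorem le_mul_kappa_one {B C : ℝ} (hα1 : 1 < α) (hα2 : α < 2) (hB : 0 ≤ B)
    (hC : ∀ g : ℝ → ℝ, ContDiff ℝ ∞ g → HasCompactSupport g → tsupport g ⊆ Ioi 0 →
      energy α (Ioi 0) g ≠ ⊤ →
      ENNReal.ofReal C * ∫⁻ s in Ioi (0 : ℝ), ‖g s‖ₑ ^ 2 * (ENNReal.ofReal s ^ α)⁻¹ ≤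
        ENNReal.ofReal B * energy α (Ioi 0) g) :
    C ≤ B * kappa 1 α := by
  have hα0 : 0 < α := by linarith
  obtain ⟨χ, hχ, hχs, hχc, hN0, hNtop⟩ := exists_contDiff_lintegral_sq (volume : Measure ℝ)
  rw [Real.closedBall_eq_Icc, zero_sub, zero_add] at hχs
  have hχm : Measurable χ := hχ.continuous.measurable
  set N := ∫⁻ s, ‖χ s‖ₑ ^ 2
  obtain ⟨K, hKtop, hK⟩ := exists_lintegral_sub_shift_le volume (hχ.of_le (by simp)) hχc
  have hbound : ∀ R : ℝ, 0 < R → ENNReal.ofReal C * N ≤ ENNReal.ofReal B *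
      (ENNReal.ofReal (kappa 1 α) * N + K * (ENNReal.ofReal (R ^ (-α)) * tailConst α)) := by
    intro R hR
    have hE := energy_logTest_le hα1 hα2 hR hχm hNtop hK
    have hts := tsupport_logTest_subset (p := (α - 1) / 2) hR hχs
    have hEfin : energy α (Ioi 0) (logTest ((α - 1) / 2) χ R) ≠ ⊤ := by
      refine ne_top_of_le_ne_top ?_ hE
      have := tailConst_ne_top hα0 hα2
      finiteness
    have h := hC (logTest ((α - 1) / 2) χ R) (contDiff_logTest hR hχs hχ)
      (HasCompactSupport.of_support_subset_isCompact isCompact_Icc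
        (support_logTest_subset hR hχs))
      (hts.trans fun x hx ↦ (Real.exp_pos _).trans_le hx.1) hEfin
    rw [lintegral_logTest hR] at h
    have hR0 : ENNReal.ofReal R ≠ 0 := by simpa using hR
    rw [← ENNReal.mul_le_mul_iff_right hR0 ENNReal.ofReal_ne_top, mul_left_comm,
      mul_left_comm (ENNReal.ofReal R)]
    exact h.trans (by gcongr)
  have hlim : Tendsto (fun R : ℝ ↦ ENNReal.ofReal B * (ENNReal.ofReal (kappa 1 α) * N +
      K * (ENNReal.ofReal (R ^ (-α)) * tailConst α))) atTop
      (𝓝 (ENNReal.ofReal B * (ENNReal.ofReal (kappa 1 α) * N +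
        K * (ENNReal.ofReal 0 * tailConst α)))) := by
    have h0 := ENNReal.tendsto_ofReal (tendsto_rpow_neg_atTop hα0)
    refine ENNReal.Tendsto.const_mul (tendsto_const_nhds.add (ENNReal.Tendsto.const_mul
      (ENNReal.Tendsto.mul_const h0 (Or.inr (tailConst_ne_top hα0 hα2))) (Or.inr hKtop)))
      (Or.inr ENNReal.ofReal_ne_top)
  have hfinal := ge_of_tendsto hlim ((eventually_gt_atTop (0 : ℝ)).mono hbound)
  simp only [ENNReal.ofReal_zero, zero_mul, mul_zero, add_zero] at hfinal
  rw [← mul_assoc, ENNReal.mul_le_mul_iff_left hN0 hNtop, ← ENNReal.ofReal_mul hB] at hfinal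
  exact (ENNReal.ofReal_le_ofReal_iff (mul_nonneg hB (kappa_one_pos hα1 hα2).le)).1 hfinal

end LogTest


section HalfSpace

variable {n m : ℕ} {α η : ℝ}

/-- Orthogonal coordinates `x ↦ (Q x, ⟨ν, x⟩)` adapted to a unit vector `ν`. -/
structure IsOrthogonalCoord (ν : E n) (L : E m →ₗᵢ[ℝ] E n) (Q : E n →L[ℝ] E m) : Prop where
  proj (z : E m) (s : ℝ) : Q (L z + s • ν) = z
  height (z : E m) (s : ℝ) : inner ℝ ν (L z + s • ν) = s
  norm_le (x : E n) : ‖Q x‖ ≤ ‖x‖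
  eq (x : E n) : L (Q x) + (inner ℝ ν x : ℝ) • ν = x
  lintegral (F : E n → ℝ≥0∞) : Measurable F → ∫⁻ x, F x = ∫⁻ z, ∫⁻ s : ℝ, F (L z + s • ν)

theorem exists_isOrthogonalCoord {ν : E n} (hν : ‖ν‖ = 1) :
    ∃ (m : ℕ) (L : E m →ₗᵢ[ℝ] E n) (Q : E n →L[ℝ] E m), IsOrthogonalCoord ν L Q := by
  obtain ⟨m, L, -, hL, hsurj, hFub⟩ := exists_lintegral_fiber hν
  set Q := ContinuousLinearMap.adjoint L.toContinuousLinearMap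
  have hQ : ∀ y x, inner ℝ y (Q x) = inner ℝ (L y) x := fun y x ↦
    ContinuousLinearMap.adjoint_inner_right _ _ _
  have hproj : ∀ z (s : ℝ), Q (L z + s • ν) = z := fun z s ↦ by
    refine ext_inner_left ℝ fun y ↦ ?_
    rw [hQ, inner_add_right, L.inner_map_map, inner_smul_right, real_inner_comm ν, hL, mul_zero,
      add_zero]
  have hinner : ∀ z (s : ℝ), inner ℝ ν (L z + s • ν) = s := fun z s ↦ by
    rw [inner_add_right, hL, inner_smul_right, real_inner_self_eq_norm_sq, hν]; ring
  refine ⟨m, L, Q, hproj, hinner, fun x ↦ ?_, fun x ↦ ?_, hFub⟩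
  · refine (Q.le_opNorm x).trans (mul_le_of_le_one_left (norm_nonneg _) ?_)
    rw [LinearIsometryEquiv.norm_map]
    exact L.norm_toContinuousLinearMap_le
  · obtain ⟨z, s, rfl⟩ := hsurj x
    rw [hproj, hinner]

variable {ν : E n} {L : E m →ₗᵢ[ℝ] E n} {Q : E n →L[ℝ] E m}

theorem isTestFun_tensor (h : IsOrthogonalCoord ν L Q) {g : ℝ → ℝ} (hg : ContDiff ℝ ∞ g)
    (hgc : HasCompactSupport g) (hgs : tsupport g ⊆ Ioi 0) {ψ : E m → ℝ} (hψ : ContDiff ℝ ∞ ψ)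
    (hψc : HasCompactSupport ψ) :
    IsTestFun {x : E n | 0 < (inner ℝ ν x : ℝ)} fun x ↦ g (inner ℝ ν x) * ψ (Q x) := by
  set K : Set (E n) := (fun q : E m × ℝ ↦ L q.1 + q.2 • ν) '' (tsupport ψ ×ˢ tsupport g)
  have hK : IsCompact K := (hψc.isCompact.prod hgc.isCompact).image (by fun_prop)
  have hsub : (Function.support fun x ↦ g (inner ℝ ν x) * ψ (Q x)) ⊆ K := fun x hx ↦
    ⟨(Q x, inner ℝ ν x), ⟨subset_tsupport _ (right_ne_zero_of_mul hx),
      subset_tsupport _ (left_ne_zero_of_mul hx)⟩, h.eq x⟩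
  refine ⟨(hg.comp (contDiff_const.inner ℝ contDiff_id)).mul (hψ.comp Q.contDiff),
    HasCompactSupport.of_support_subset_isCompact hK hsub,
    (closure_minimal hsub hK.isClosed).trans ?_⟩
  rintro _ ⟨⟨z, s⟩, hq, rfl⟩
  rw [mem_ofPred_eq, h.height]
  exact hgs hq.2

theorem lintegral_tensor (h : IsOrthogonalCoord ν L Q) {g : ℝ → ℝ} (hg : Measurable g)
    {ψ : E m → ℝ} (hψ : Measurable ψ) :
    ∫⁻ x in {x : E n | 0 < (inner ℝ ν x : ℝ)}, ‖g (inner ℝ ν x) * ψ (Q x)‖ₑ ^ 2 *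
        (ENNReal.ofReal (inner ℝ ν x) ^ α)⁻¹ =
      (∫⁻ z, ‖ψ z‖ₑ ^ 2) * ∫⁻ s in Ioi (0 : ℝ), ‖g s‖ₑ ^ 2 * (ENNReal.ofReal s ^ α)⁻¹ := by
  have hm : MeasurableSet {x : E n | 0 < (inner ℝ ν x : ℝ)} :=
    measurableSet_lt measurable_const (by fun_prop)
  rw [← lintegral_indicator hm, h.lintegral _ (Measurable.indicator (by fun_prop) hm),
    ← lintegral_mul_const _ (by fun_prop)]
  refine lintegral_congr fun z ↦ ?_
  rw [← lintegral_const_mul _ (by fun_prop), ← lintegral_indicator measurableSet_Ioi]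
  refine lintegral_congr fun s ↦ ?_
  simp only [indicator, mem_ofPred_eq, h.height, h.proj, mem_Ioi, enorm_mul, mul_pow]
  split_ifs
  · ring
  · rfl

theorem enorm_add_sq_le (hη : 0 < η) (a b : ℝ) :
    ‖a + b‖ₑ ^ 2 ≤ ENNReal.ofReal (1 + η) * ‖a‖ₑ ^ 2 + ENNReal.ofReal (1 + η⁻¹) * ‖b‖ₑ ^ 2 := by
  have hsq : ∀ x : ℝ, ‖x‖ₑ ^ 2 = ENNReal.ofReal (x ^ 2) := fun x ↦ by
    rw [← ofReal_norm, ← ENNReal.ofReal_pow (norm_nonneg _), Real.norm_eq_abs, sq_abs]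
  simp only [hsq]
  rw [← ENNReal.ofReal_mul (by positivity), ← ENNReal.ofReal_mul (by positivity),
    ← ENNReal.ofReal_add (by positivity) (by positivity)]
  refine ENNReal.ofReal_le_ofReal ?_
  have h : 0 ≤ η⁻¹ * (η * a - b) ^ 2 := by positivity
  have h2 : η⁻¹ * (η * a - b) ^ 2 = η * a ^ 2 - 2 * (a * b) + η⁻¹ * b ^ 2 := by
    field_simp; ring
  nlinarith

theorem lineEnergy_tensor_le (h : IsOrthogonalCoord ν L Q) (hα : 0 < α) (hη : 0 < η) {g : ℝ → ℝ}
    (hg : Measurable g) {ψ : E m → ℝ} (hψ : Measurable ψ) (w : E n) :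
    lineEnergy α {x : E n | 0 < (inner ℝ ν x : ℝ)} (fun x ↦ g (inner ℝ ν x) * ψ (Q x)) w ≤
      ENNReal.ofReal (1 + η) * (ENNReal.ofReal |inner ℝ ν w| ^ α * energy α (Ioi 0) g *
        ∫⁻ z, ‖ψ z‖ₑ ^ 2) +
      ENNReal.ofReal (1 + η⁻¹) * ((∫⁻ s, ‖g s‖ₑ ^ 2) * ∫⁻ r in Ioi (0 : ℝ),
        (∫⁻ z, ‖ψ z - ψ (z + r • Q w)‖ₑ ^ 2) / ENNReal.ofReal r ^ (1 + α)) := by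
  have hm : MeasurableSet {x : E n | 0 < (inner ℝ ν x : ℝ)} :=
    measurableSet_lt measurable_const (by fun_prop)
  have hfm : Measurable fun x : E n ↦ g (inner ℝ ν x) * ψ (Q x) := by fun_prop
  set c : ℝ := inner ℝ ν w with hc
  set H := {x : E n | 0 < (inner ℝ ν x : ℝ)} with hH
  have hadd : ∀ z (s r : ℝ), L z + s • ν + r • w = L (z + r • Q w) + (s + r * c) • ν := by
    intro z s r
    conv_lhs => rw [← h.eq w]
    rw [map_add, map_smul, smul_add, smul_smul, add_smul]
    abel
  have hi : Measurable ((Ioi (0 : ℝ)).indicator (1 : ℝ → ℝ≥0∞)) :=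
    measurable_one.indicator measurableSet_Ioi
  have hind : ∀ z (s : ℝ), H.indicator (1 : E n → ℝ≥0∞) (L z + s • ν) =
      (Ioi 0).indicator 1 s := fun z s ↦ by
    simp only [indicator, hH, mem_ofPred_eq, h.height, mem_Ioi, Pi.one_apply]
  rw [← increment_eq hα measurableSet_Ioi hg c, lineEnergy, increment,
    lintegral_lintegral_swap (by
      exact (measurable_lineEnergy_integrand hm hfm (x := fun q : E n × ℝ ↦ q.1) (w := fun _ ↦ w)
        (r := fun q ↦ q.2) (by fun_prop) (by fun_prop) (by fun_prop)).aemeasurable),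
    lintegral_lintegral_swap (f := fun s r ↦ (Ioi 0).indicator 1 s *
      (Ioi 0).indicator 1 (s + r * c) * (‖g s - g (s + r * c)‖ₑ ^ 2 / ENNReal.ofReal r ^ (1 + α)))
      (measurable_increment_integrand measurableSet_Ioi hg c).aemeasurable]
  have hI1 : Measurable fun r : ℝ ↦ ∫⁻ s, (Ioi 0).indicator 1 s * (Ioi 0).indicator 1 (s + r * c) *
      (‖g s - g (s + r * c)‖ₑ ^ 2 / ENNReal.ofReal r ^ (1 + α)) := by
    refine Measurable.lintegral_prod_left' (f := fun q : ℝ × ℝ ↦ (Ioi 0).indicator 1 q.1 *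
      (Ioi 0).indicator 1 (q.1 + q.2 * c) *
      (‖g q.1 - g (q.1 + q.2 * c)‖ₑ ^ 2 / ENNReal.ofReal q.2 ^ (1 + α))) ?_
    exact measurable_increment_integrand measurableSet_Ioi hg c
  have hI2 : Measurable fun r : ℝ ↦
      (∫⁻ z, ‖ψ z - ψ (z + r • Q w)‖ₑ ^ 2) / ENNReal.ofReal r ^ (1 + α) := by
    refine Measurable.div ?_ (by fun_prop)
    refine Measurable.lintegral_prod_left'
      (f := fun q : E m × ℝ ↦ ‖ψ q.1 - ψ (q.1 + q.2 • Q w)‖ₑ ^ 2) ?_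
    fun_prop
  rw [← lintegral_mul_const _ hI1, ← lintegral_const_mul _ hI2,
    ← lintegral_const_mul _ (hI1.mul_const _), ← lintegral_const_mul _ (hI2.const_mul _),
    ← lintegral_add_left ((hI1.mul_const _).const_mul _)]
  refine lintegral_mono fun r ↦ ?_
  set G := ∫⁻ s, ‖g s‖ₑ ^ 2 with hG
  set k := ENNReal.ofReal r ^ (1 + α) with hk
  set I := ∫⁻ s, (Ioi 0).indicator 1 s * (Ioi 0).indicator 1 (s + r * c) *
      (‖g s - g (s + r * c)‖ₑ ^ 2 / k) with hI
  have hGs : ∫⁻ s, ‖g (s + r * c)‖ₑ ^ 2 = G :=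
    lintegral_add_right_eq_self (μ := volume) (fun s ↦ ‖g s‖ₑ ^ 2) (r * c)
  have hind_le : ∀ s, (Ioi (0 : ℝ)).indicator (1 : ℝ → ℝ≥0∞) s ≤ 1 :=
    fun s ↦ indicator_le_self' (fun _ _ ↦ zero_le) s
  rw [h.lintegral _ (measurable_lineEnergy_integrand hm hfm (by fun_prop) (by fun_prop)
    (by fun_prop))]
  have hpt : ∀ z (s : ℝ), H.indicator 1 (L z + s • ν) * H.indicator 1 (L z + s • ν + r • w) *
      (‖g (inner ℝ ν (L z + s • ν)) * ψ (Q (L z + s • ν)) -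
        g (inner ℝ ν (L z + s • ν + r • w)) * ψ (Q (L z + s • ν + r • w))‖ₑ ^ 2 / k) ≤
      (ENNReal.ofReal (1 + η) * ‖ψ z‖ₑ ^ 2) * ((Ioi 0).indicator 1 s *
        (Ioi 0).indicator 1 (s + r * c) * (‖g s - g (s + r * c)‖ₑ ^ 2 / k)) +
      (ENNReal.ofReal (1 + η⁻¹) * (‖ψ z - ψ (z + r • Q w)‖ₑ ^ 2 / k)) * ‖g (s + r * c)‖ₑ ^ 2 := by
    intro z s
    rw [hadd]
    simp only [hind, h.height, h.proj]
    have e : g s * ψ z - g (s + r * c) * ψ (z + r • Q w) =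
        (g s - g (s + r * c)) * ψ z + g (s + r * c) * (ψ z - ψ (z + r • Q w)) := by ring
    have h1 := enorm_add_sq_le hη ((g s - g (s + r * c)) * ψ z)
      (g (s + r * c) * (ψ z - ψ (z + r • Q w)))
    rw [← e] at h1
    simp only [enorm_mul, mul_pow] at h1
    set i := (Ioi (0 : ℝ)).indicator (1 : ℝ → ℝ≥0∞) s * (Ioi (0 : ℝ)).indicator 1 (s + r * c)
    have hi1 : i ≤ 1 := mul_le_one' (hind_le _) (hind_le _)
    calc i * (‖g s * ψ z - g (s + r * c) * ψ (z + r • Q w)‖ₑ ^ 2 / k)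
        ≤ i * ((ENNReal.ofReal (1 + η) * (‖g s - g (s + r * c)‖ₑ ^ 2 * ‖ψ z‖ₑ ^ 2) +
            ENNReal.ofReal (1 + η⁻¹) *
              (‖g (s + r * c)‖ₑ ^ 2 * ‖ψ z - ψ (z + r • Q w)‖ₑ ^ 2)) / k) := by gcongr
      _ = ENNReal.ofReal (1 + η) * ‖ψ z‖ₑ ^ 2 * (i * (‖g s - g (s + r * c)‖ₑ ^ 2 / k)) +
          i * (ENNReal.ofReal (1 + η⁻¹) * (‖ψ z - ψ (z + r • Q w)‖ₑ ^ 2 / k) *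
            ‖g (s + r * c)‖ₑ ^ 2) := by
        simp only [div_eq_mul_inv]; ring
      _ ≤ _ := by
        exact add_le_add le_rfl ((mul_le_mul' hi1 le_rfl).trans_eq (one_mul _))
  refine (lintegral_mono fun z ↦ lintegral_mono fun s ↦ hpt z s).trans_eq ?_
  have hm1 : Measurable fun s : ℝ ↦ (Ioi 0).indicator 1 s *
        (Ioi 0).indicator 1 (s + r * c) * (‖g s - g (s + r * c)‖ₑ ^ 2 / k) := by fun_prop
  have hinner : ∀ z, ∫⁻ s, ((ENNReal.ofReal (1 + η) * ‖ψ z‖ₑ ^ 2) * ((Ioi 0).indicator 1 s *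
        (Ioi 0).indicator 1 (s + r * c) * (‖g s - g (s + r * c)‖ₑ ^ 2 / k)) +
      (ENNReal.ofReal (1 + η⁻¹) * (‖ψ z - ψ (z + r • Q w)‖ₑ ^ 2 / k)) *
        ‖g (s + r * c)‖ₑ ^ 2) = ENNReal.ofReal (1 + η) * I * ‖ψ z‖ₑ ^ 2 +
          ENNReal.ofReal (1 + η⁻¹) * G * k⁻¹ * ‖ψ z - ψ (z + r • Q w)‖ₑ ^ 2 := by
    intro z
    rw [lintegral_add_left (hm1.const_mul _), lintegral_const_mul _ hm1,
      lintegral_const_mul _ (by fun_prop), hGs, div_eq_mul_inv]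
    ring
  rw [lintegral_congr hinner, lintegral_add_left (by fun_prop), lintegral_const_mul _ (by fun_prop),
    lintegral_const_mul _ (by fun_prop), div_eq_mul_inv]
  ring

theorem mul_lintegral_le_energy [NeZero n] {C : ℝ} (hα0 : 0 < α) (hα2 : α < 2) (hν : ‖ν‖ = 1)
    (hH : HardyInequality ℝ α {x : E n | 0 < (inner ℝ ν x : ℝ)}
      (fun x ↦ (ENNReal.ofReal (inner ℝ ν x) ^ α)⁻¹) C)
    {g : ℝ → ℝ} (hg : ContDiff ℝ ∞ g) (hgc : HasCompactSupport g) (hgs : tsupport g ⊆ Ioi 0)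
    (hE : energy α (Ioi 0) g ≠ ⊤) :
    ENNReal.ofReal C * ∫⁻ s in Ioi (0 : ℝ), ‖g s‖ₑ ^ 2 * (ENNReal.ofReal s ^ α)⁻¹ ≤
      ENNReal.ofReal (sphereConst n α / 2) * energy α (Ioi 0) g := by
  obtain ⟨m, L, Q, h⟩ := exists_isOrthogonalCoord hν
  obtain ⟨φ, hφ, -, hφc, hA0, hAtop⟩ := exists_contDiff_lintegral_sq (volume : Measure (E m))
  obtain ⟨K, hKtop, hK⟩ := exists_lintegral_sub_shift_le (volume : Measure (E m))
    (hφ.of_le (by simp)) hφc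
  have hGtop := lintegral_enorm_sq_ne_top volume hg.continuous hgc
  have hTtop := tailConst_ne_top hα0 hα2
  have hgm := hg.continuous.measurable
  have hφm := hφ.continuous.measurable
  have hm : MeasurableSet {x : E n | 0 < (inner ℝ ν x : ℝ)} :=
    measurableSet_lt measurable_const (by fun_prop)
  set A := ∫⁻ z, ‖φ z‖ₑ ^ 2
  set G := ∫⁻ s, ‖g s‖ₑ ^ 2
  set En := energy α (Ioi 0) g
  set N := ∫⁻ s in Ioi (0 : ℝ), ‖g s‖ₑ ^ 2 * (ENNReal.ofReal s ^ α)⁻¹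
  set S := ENNReal.ofReal (sphereConst n α) with hS
  set A' := (volume : Measure (E n)).toSphere univ
  have hA' : A' ≠ ⊤ := measure_ne_top _ _
  have hbound : ∀ η : ℝ, 0 < η → ∀ R : ℝ, 0 < R → ENNReal.ofReal C * (A * N) ≤ (1 / 2) *
      (ENNReal.ofReal (1 + η) * (S * En * A) + ENNReal.ofReal (1 + η⁻¹) *
        (G * (K * (ENNReal.ofReal (R ^ (-α)) * tailConst α))) * A') := by
    intro η hη R hR
    set ψ : E m → ℝ := fun z ↦ φ (R⁻¹ • z) with hψ
    have hψm : Measurable ψ := by fun_prop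
    have hscale : ∀ F : E m → ℝ≥0∞,
        ∫⁻ z, F (R⁻¹ • z) = ENNReal.ofReal (R ^ Module.finrank ℝ (E m)) * ∫⁻ z, F z := fun F ↦ by
      simpa using lintegral_comp_scale volume hR (0 : E m) F
    have hψc : HasCompactSupport ψ := hφc.comp_smul (inv_ne_zero hR.ne')
    set q := ENNReal.ofReal (R ^ Module.finrank ℝ (E m)) with hq
    have hq0 : q ≠ 0 := by
      rw [hq, ne_eq, ENNReal.ofReal_eq_zero, not_le]; positivity
    have hψA : ∫⁻ z, ‖ψ z‖ₑ ^ 2 = q * A := hscale fun z ↦ ‖φ z‖ₑ ^ 2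
    have hline : ∀ w : sphere (0 : E n) 1,
        lineEnergy α {x : E n | 0 < (inner ℝ ν x : ℝ)} (fun x ↦ g (inner ℝ ν x) * ψ (Q x)) w ≤
        q * (ENNReal.ofReal (1 + η) * (En * A) * ENNReal.ofReal |inner ℝ ν (w : E n)| ^ α +
          ENNReal.ofReal (1 + η⁻¹) *
            (G * (K * (ENNReal.ofReal (R ^ (-α)) * tailConst α)))) := by
      intro w
      have hD : ∫⁻ r in Ioi (0 : ℝ),
          (∫⁻ z, ‖ψ z - ψ (z + r • Q w)‖ₑ ^ 2) / ENNReal.ofReal r ^ (1 + α) ≤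
          q * (K * (ENNReal.ofReal (R ^ (-α)) * tailConst α)) := by
        rw [← lintegral_tail_scale hα0 hR, ← lintegral_const_mul _ (by fun_prop),
          ← lintegral_const_mul _ (by fun_prop)]
        refine setLIntegral_mono' measurableSet_Ioi fun r hr ↦ ?_
        have hr : 0 < r := hr
        rw [← mul_div_assoc, ← mul_div_assoc]
        gcongr ?_ / _
        have h1 := hscale fun z ↦ ‖φ z - φ (z + R⁻¹ • r • Q w)‖ₑ ^ 2
        simp only [← smul_add] at h1
        rw [h1]
        gcongr q * ?_
        refine (hK _).trans ?_
        gcongr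
        rw [norm_smul, norm_smul, Real.norm_of_nonneg hr.le,
          Real.norm_of_nonneg (inv_pos.2 hR).le, mul_comm]
        have h2 : ‖Q w‖ ≤ 1 := (h.norm_le w).trans_eq (norm_eq_of_mem_sphere w)
        gcongr
        exact mul_le_of_le_one_right hr.le h2
      refine (lineEnergy_tensor_le h hα0 hη hgm hψm w).trans ?_
      rw [hψA]
      calc _ ≤ ENNReal.ofReal (1 + η) * (ENNReal.ofReal |inner ℝ ν (w : E n)| ^ α * En * (q * A)) +
            ENNReal.ofReal (1 + η⁻¹) * (G * (q * (K * (ENNReal.ofReal (R ^ (-α)) *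
              tailConst α)))) := by gcongr
        _ = _ := by ring
    have hψs : ContDiff ℝ ∞ ψ := hφ.comp (contDiff_const_smul R⁻¹)
    have htest := hH _ (isTestFun_tensor h hg hgc hgs hψs hψc)
    have hfm : Measurable fun x : E n ↦ g (inner ℝ ν x) * ψ (Q x) := by fun_prop
    have hsph : Measurable fun w : sphere (0 : E n) 1 ↦
        ENNReal.ofReal |inner ℝ ν (w : E n)| ^ α := by fun_prop
    have hleft := lintegral_tensor (α := α) h hgm hψm
    rw [hψA] at hleft
    have hright : gagliardo α {x : E n | 0 < (inner ℝ ν x : ℝ)}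
        (fun x ↦ g (inner ℝ ν x) * ψ (Q x)) ≤ q * (ENNReal.ofReal (1 + η) * (S * En * A) +
          ENNReal.ofReal (1 + η⁻¹) *
            (G * (K * (ENNReal.ofReal (R ^ (-α)) * tailConst α))) * A') := by
      rw [gagliardo_eq_lintegral_lineEnergy hm hfm]
      refine (lintegral_mono hline).trans_eq ?_
      rw [lintegral_const_mul' _ _ ENNReal.ofReal_ne_top, lintegral_add_right _ measurable_const,
        lintegral_const_mul _ hsph, lintegral_const, hS, ← sphereMoment_eq hα0 hν, sphereMoment]
      ring
    have hfin : ENNReal.ofReal C * (q * A * N) ≤ (1 / 2) * (q * (ENNReal.ofReal (1 + η) *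
        (S * En * A) + ENNReal.ofReal (1 + η⁻¹) *
            (G * (K * (ENNReal.ofReal (R ^ (-α)) * tailConst α))) * A')) := by
      rw [← hleft]
      exact htest.trans (by gcongr)
    rw [mul_assoc, mul_left_comm, mul_left_comm (1 / 2),
      ENNReal.mul_le_mul_iff_right hq0 ENNReal.ofReal_ne_top] at hfin
    exact hfin
  have hbound2 : ∀ η : ℝ, 0 < η → ENNReal.ofReal C * N ≤
      (1 / 2) * (ENNReal.ofReal (1 + η) * (S * En)) := by
    intro η hη
    have h0 := ENNReal.tendsto_ofReal (tendsto_rpow_neg_atTop hα0)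
    have hlim := ENNReal.Tendsto.const_mul (a := 1 / 2) (tendsto_const_nhds
      (x := ENNReal.ofReal (1 + η) * (S * En * A)) |>.add <| ENNReal.Tendsto.mul_const
      (ENNReal.Tendsto.const_mul (a := ENNReal.ofReal (1 + η⁻¹)) (ENNReal.Tendsto.const_mul
        (ENNReal.Tendsto.const_mul (ENNReal.Tendsto.mul_const h0 (Or.inr hTtop)) (Or.inr hKtop))
        (Or.inr hGtop)) (Or.inr ENNReal.ofReal_ne_top)) (Or.inr hA')) (Or.inr (by simp))
    have hle := ge_of_tendsto hlim ((eventually_gt_atTop (0 : ℝ)).mono (hbound η hη))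
    simp only [ENNReal.ofReal_zero, zero_mul, mul_zero, add_zero] at hle
    rw [← ENNReal.mul_le_mul_iff_right hA0 hAtop]
    calc _ = _ := mul_left_comm _ _ _
      _ ≤ _ := hle
      _ = _ := by ring
  have hlim : Tendsto (fun η : ℝ ↦ (1 / 2) * (ENNReal.ofReal (1 + η) * (S * En))) (𝓝[>] 0)
      (𝓝 ((1 / 2) * (ENNReal.ofReal (1 + 0) * (S * En)))) := by
    have h0 : Tendsto (fun η : ℝ ↦ 1 + η) (𝓝[>] 0) (𝓝 (1 + 0)) :=
      tendsto_const_nhds.add (tendsto_nhdsWithin_of_tendsto_nhds tendsto_id)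
    exact ENNReal.Tendsto.const_mul (ENNReal.Tendsto.mul_const (ENNReal.tendsto_ofReal h0)
      (Or.inr (ENNReal.mul_ne_top ENNReal.ofReal_ne_top hE))) (Or.inr (by simp))
  refine (ge_of_tendsto hlim (eventually_nhdsWithin_of_forall hbound2)).trans_eq ?_
  rw [add_zero, ENNReal.ofReal_one, one_mul, ← mul_assoc, hS, ENNReal.ofReal_div_of_pos zero_lt_two,
    ENNReal.ofReal_ofNat, one_div, mul_comm 2⁻¹, ← div_eq_mul_inv]

end HalfSpace


section Sharpness

variable {𝕜 : Type*} [RCLike 𝕜] {n : ℕ} {α C : ℝ} {Ω : Set (E n)}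

theorem bdryDist_le_inner (hΩ : IsOpen Ω) {x z ν : E n} (hx : x ∈ Ω)
    (hν : ν ∈ supportingNormals Ω z) : bdryDist Ω x ≤ ENNReal.ofReal (inner ℝ ν (x - z)) := by
  have ht := inner_pos_of_mem_supportingNormals hΩ hν hx
  set t : ℝ := inner ℝ ν (x - z) with ht'
  have hy : x - t • ν ∉ Ω := fun hy ↦ by
    have h := inner_pos_of_mem_supportingNormals hΩ hν hy
    rw [sub_right_comm, inner_sub_right, inner_smul_right, real_inner_self_eq_norm_sq, hν.1, ← ht']
      at h
    linarith
  refine (bdryDist_le_edist hx hy).trans_eq ?_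
  rw [edist_dist, dist_eq_norm, sub_sub_cancel, norm_smul, hν.1, mul_one,
    Real.norm_of_nonneg ht.le]

/-- A compact subset of a half-space is mapped by small dilations into any ball that touches the
boundary of the half-space at the origin. -/
theorem exists_pos_smul_mem_ball {ν : E n} (hν : ‖ν‖ = 1) {r : ℝ} (hr : 0 < r) {K : Set (E n)}
    (hK : IsCompact K) (hpos : ∀ x ∈ K, 0 < (inner ℝ ν x : ℝ)) :
    ∃ c : ℝ, 0 < c ∧ ∀ x ∈ K, c • x ∈ ball (r • ν) r := by
  obtain ⟨b, hb, hbK⟩ := hK.exists_forall_le' (f := fun x ↦ (inner ℝ ν x : ℝ)) (by fun_prop) hpos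
  obtain ⟨M, hM, hMK⟩ := hK.isBounded.exists_pos_norm_le
  refine ⟨r * b / M ^ 2, by positivity, fun x hx ↦ ?_⟩
  set c := r * b / M ^ 2 with hc
  have hc0 : 0 < c := by positivity
  rw [mem_ball, dist_eq_norm]
  refine lt_of_pow_lt_pow_left₀ 2 hr.le ?_
  rw [norm_sub_sq_real, norm_smul, norm_smul, hν, inner_smul_left, inner_smul_right,
    real_inner_comm, mul_one, mul_pow, Real.norm_eq_abs, Real.norm_eq_abs, sq_abs, sq_abs]
  simp only [conj_trivial]
  have h1 : c * ‖x‖ ^ 2 ≤ r * b := by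
    calc c * ‖x‖ ^ 2 ≤ c * M ^ 2 := by gcongr; exact hMK x hx
      _ = r * b := by rw [hc]; field_simp
  have h2 : r * b ≤ r * inner ℝ ν x := by gcongr; exact hbK x hx
  have h3 : 0 < r * b := by positivity
  nlinarith

theorem isTestFun_comp_scale {c : ℝ} (hc : 0 < c) (z : E n) {H : Set (E n)} {f : E n → ℝ}
    (hf : IsTestFun H f) (hsub : ∀ x ∈ tsupport f, z + c • x ∈ Ω) :
    IsTestFun Ω fun x ↦ (f (c⁻¹ • (x - z)) : 𝕜) := by
  set K := (fun x ↦ z + c • x) '' tsupport f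
  have hK : IsCompact K := hf.2.1.isCompact.image (by fun_prop)
  have hsupp : (Function.support fun x ↦ (f (c⁻¹ • (x - z)) : 𝕜)) ⊆ K := fun x hx ↦ by
    refine ⟨c⁻¹ • (x - z), subset_tsupport _ fun h ↦ hx ?_, ?_⟩
    · simp only [h, RCLike.ofReal_zero]
    · simp only [smul_inv_smul₀ hc.ne', add_sub_cancel]
  refine ⟨?_, HasCompactSupport.of_support_subset_isCompact hK hsupp,
    (closure_minimal hsupp hK.isClosed).trans ?_⟩
  · have h1 : ContDiff ℝ ∞ fun x : E n ↦ c⁻¹ • (x - z) := by fun_prop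
    exact (RCLike.ofRealCLM (K := 𝕜)).contDiff.comp (hf.1.comp h1)
  · rintro _ ⟨x, hx, rfl⟩
    exact hsub x hx

theorem gagliardo_comp_scale_le {c : ℝ} (hc : 0 < c) (z : E n) (hΩ : MeasurableSet Ω)
    {H : Set (E n)} (hH : MeasurableSet H) (hsub : ∀ x ∈ Ω, c⁻¹ • (x - z) ∈ H) {f : E n → ℝ}
    (hf : Measurable f) :
    gagliardo α Ω (fun x ↦ (f (c⁻¹ • (x - z)) : 𝕜)) ≤
      (ENNReal.ofReal c ^ α)⁻¹ * ENNReal.ofReal (c ^ n) * gagliardo α H f := by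
  have hc' : ENNReal.ofReal c ≠ 0 := by simpa using hc
  have hcm : Measurable fun x ↦ (f (c⁻¹ • (x - z)) : 𝕜) :=
    RCLike.measurable_ofReal.comp (hf.comp (by fun_prop))
  set Γ : E n → E n → ℝ≥0∞ := fun u v ↦ H.indicator 1 u * H.indicator 1 v *
    (‖f u - f v‖ₑ ^ 2 / ‖u - v‖ₑ ^ ((n : ℝ) + α)) with hΓ
  set p := ENNReal.ofReal (c ^ n) with hp
  have hp0 : p ≠ 0 := by
    rw [hp, ne_eq, ENNReal.ofReal_eq_zero, not_le]; positivity
  set k := p⁻¹ * (ENNReal.ofReal c ^ α)⁻¹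
  have hkT : k ≠ ⊤ := by
    refine ENNReal.mul_ne_top (ENNReal.inv_ne_top.2 hp0) (ENNReal.inv_ne_top.2 ?_)
    rw [ENNReal.ofReal_rpow_of_pos hc, ne_eq, ENNReal.ofReal_eq_zero, not_le]; positivity
  have hkeq : (ENNReal.ofReal c ^ ((n : ℝ) + α))⁻¹ = k := by
    rw [ENNReal.rpow_add _ _ hc' ENNReal.ofReal_ne_top, ENNReal.rpow_natCast,
      ← ENNReal.ofReal_pow hc.le, ENNReal.mul_inv (Or.inl hp0) (Or.inl ENNReal.ofReal_ne_top)]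
  have hind : ∀ x, Ω.indicator (1 : E n → ℝ≥0∞) x ≤ H.indicator 1 (c⁻¹ • (x - z)) := fun x ↦ by
    by_cases hx : x ∈ Ω
    · rw [indicator_of_mem hx, indicator_of_mem (hsub x hx)]; rfl
    · rw [indicator_of_notMem hx]; exact zero_le
  have hpt : ∀ x y, Ω.indicator 1 x * Ω.indicator 1 y *
      (‖(f (c⁻¹ • (x - z)) : 𝕜) - (f (c⁻¹ • (y - z)) : 𝕜)‖ₑ ^ 2 / ‖x - y‖ₑ ^ ((n : ℝ) + α)) ≤
      k * Γ (c⁻¹ • (x - z)) (c⁻¹ • (y - z)) := by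
    intro x y
    set u := c⁻¹ • (x - z) with hu
    set v := c⁻¹ • (y - z) with hv
    have e1 : ‖(f u : 𝕜) - (f v : 𝕜)‖ₑ = ‖f u - f v‖ₑ := by
      rw [← RCLike.ofReal_sub, ← ofReal_norm, RCLike.norm_ofReal, ← Real.norm_eq_abs, ofReal_norm]
    have e2 : ‖x - y‖ₑ ^ ((n : ℝ) + α) =
        ENNReal.ofReal c ^ ((n : ℝ) + α) * ‖u - v‖ₑ ^ ((n : ℝ) + α) := by
      have : x - y = c • (u - v) := by
        rw [hu, hv, ← smul_sub, smul_inv_smul₀ hc.ne', sub_sub_sub_cancel_right]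
      rw [this, enorm_smul, Real.enorm_eq_ofReal hc.le,
        ENNReal.mul_rpow_of_ne_top ENNReal.ofReal_ne_top enorm_ne_top]
    have hcT' : ENNReal.ofReal c ^ ((n : ℝ) + α) ≠ ⊤ := by
      rw [ENNReal.ofReal_rpow_of_pos hc]; exact ENNReal.ofReal_ne_top
    have hc0' : ENNReal.ofReal c ^ ((n : ℝ) + α) ≠ 0 := by
      rw [ENNReal.ofReal_rpow_of_pos hc, ne_eq, ENNReal.ofReal_eq_zero, not_le]; positivity
    rw [e1, e2, hΓ, div_eq_mul_inv, ENNReal.mul_inv (Or.inl hc0') (Or.inl hcT'), hkeq]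
    calc _ ≤ H.indicator 1 u * H.indicator 1 v *
          (‖f u - f v‖ₑ ^ 2 * (k * (‖u - v‖ₑ ^ ((n : ℝ) + α))⁻¹)) := by
          gcongr <;> exact hind _
      _ = _ := by simp only [div_eq_mul_inv]; ring
  have hscale : ∀ F : E n → ℝ≥0∞, ∫⁻ x, F (c⁻¹ • (x - z)) = p * ∫⁻ x, F x := fun F ↦ by
    rw [lintegral_comp_scale volume hc z F, finrank_euclideanSpace_fin]
  rw [gagliardo_eq_lintegral hΩ hcm, gagliardo_eq_lintegral hH hf]
  refine (lintegral_mono fun x ↦ lintegral_mono (hpt x)).trans_eq ?_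
  simp only [lintegral_const_mul' _ _ hkT, hscale]
  rw [hscale fun u ↦ p * ∫⁻ v, Γ u v, lintegral_const_mul' _ _ ENNReal.ofReal_ne_top]
  change p⁻¹ * (ENNReal.ofReal c ^ α)⁻¹ * (p * (p * ∫⁻ u, ∫⁻ v, Γ u v)) =
    (ENNReal.ofReal c ^ α)⁻¹ * p * ∫⁻ u, ∫⁻ v, Γ u v
  calc _ = p⁻¹ * p * ((ENNReal.ofReal c ^ α)⁻¹ * p * ∫⁻ u, ∫⁻ v, Γ u v) := by ring
    _ = _ := by rw [ENNReal.inv_mul_cancel hp0 ENNReal.ofReal_ne_top, one_mul]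

theorem HardyInequality.halfSpace (hΩ : IsOpen Ω) (hα : 0 < α) {x z ν : E n}
    (hx : x ∈ Ω) (hz : z ∈ closestBdryPoints Ω x) (hν : ν ∈ supportingNormals Ω z)
    (hH : HardyInequality 𝕜 α Ω (weightd α Ω) C) :
    HardyInequality ℝ α {x : E n | 0 < (inner ℝ ν x : ℝ)}
      (fun x ↦ (ENNReal.ofReal (inner ℝ ν x) ^ α)⁻¹) C := by
  intro f hf
  set H := {x : E n | 0 < (inner ℝ ν x : ℝ)}
  have hHm : MeasurableSet H := measurableSet_lt measurable_const (by fun_prop)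
  have hinner := inner_eq_dist_of_mem_supportingNormals hx hz hν
  have hr : 0 < dist x z := hinner ▸ inner_pos_of_mem_supportingNormals hΩ hν hx
  have hxz : x = z + dist x z • ν := by
    have h := (inner_eq_norm_mul_iff_real (x := ν) (y := x - z)).1 (by
      rw [hinner, hν.1, one_mul, dist_eq_norm])
    rw [hν.1, one_smul, ← dist_eq_norm] at h
    rw [h, add_sub_cancel]
  obtain ⟨c, hc, hcK⟩ := exists_pos_smul_mem_ball hν.1 hr hf.2.1.isCompact hf.2.2
  have hsub : ∀ y ∈ tsupport f, z + c • y ∈ Ω := fun y hy ↦ by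
    refine ball_subset_of_mem_closestBdryPoints hx hz ?_
    have h := hcK y hy
    rw [mem_ball, dist_eq_norm] at h ⊢
    nth_rw 1 [hxz]
    rwa [add_sub_add_left_eq_sub]
  have hinv : ∀ y, inner ℝ ν (y - z) = c * inner ℝ ν (c⁻¹ • (y - z)) := fun y ↦ by
    rw [inner_smul_right, mul_inv_cancel_left₀ hc.ne']
  have hΩH : ∀ y ∈ Ω, c⁻¹ • (y - z) ∈ H := fun y hy ↦ by
    have h := inner_pos_of_mem_supportingNormals hΩ hν hy
    rw [hinv] at h
    exact pos_of_mul_pos_right h hc.le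
  have hfm := hf.1.continuous.measurable
  have htest := hH _ (isTestFun_comp_scale (𝕜 := 𝕜) hc z hf hsub)
  have hright := gagliardo_comp_scale_le (𝕜 := 𝕜) (α := α) hc z hΩ.measurableSet hHm hΩH hfm
  set a := (ENNReal.ofReal c ^ α)⁻¹ with ha
  set p := ENNReal.ofReal (c ^ n) with hp
  have hp0 : p ≠ 0 := by
    rw [hp, ne_eq, ENNReal.ofReal_eq_zero, not_le]; positivity
  have hc0 : ENNReal.ofReal c ^ α ≠ 0 := by
    rw [ENNReal.ofReal_rpow_of_pos hc, ne_eq, ENNReal.ofReal_eq_zero, not_le]; positivity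
  have hcT : ENNReal.ofReal c ^ α ≠ ⊤ := by
    rw [ENNReal.ofReal_rpow_of_pos hc]; exact ENNReal.ofReal_ne_top
  have ha0 : a ≠ 0 := ENNReal.inv_ne_zero.2 hcT
  have haT : a ≠ ⊤ := ENNReal.inv_ne_top.2 hc0
  have hleft : a * p * ∫⁻ x in H, ‖f x‖ₑ ^ 2 * (ENNReal.ofReal (inner ℝ ν x) ^ α)⁻¹ ≤
      ∫⁻ x in Ω, ‖(f (c⁻¹ • (x - z)) : 𝕜)‖ₑ ^ 2 * weightd α Ω x := by
    have hs := lintegral_comp_scale volume hc z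
      (H.indicator fun x ↦ ‖f x‖ₑ ^ 2 * (ENNReal.ofReal (inner ℝ ν x) ^ α)⁻¹)
    rw [finrank_euclideanSpace_fin, lintegral_indicator hHm] at hs
    rw [mul_assoc, ← hs, ← lintegral_const_mul' _ _ haT, ← lintegral_indicator hΩ.measurableSet]
    refine lintegral_mono fun y ↦ ?_
    by_cases hy : y ∈ Ω
    · rw [indicator_of_mem hy, indicator_of_mem (hΩH y hy), mul_left_comm]
      have e1 : ‖(f (c⁻¹ • (y - z)) : 𝕜)‖ₑ = ‖f (c⁻¹ • (y - z))‖ₑ := by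
        rw [← ofReal_norm, RCLike.norm_ofReal, ← Real.norm_eq_abs, ofReal_norm]
      rw [e1]
      gcongr
      rw [weightd, ha, ← ENNReal.mul_inv (Or.inl hc0) (Or.inl hcT),
        ← ENNReal.mul_rpow_of_nonneg _ _ hα.le, ← ENNReal.ofReal_mul hc.le, ← hinv]
      gcongr
      exact bdryDist_le_inner hΩ hy hν
    · rw [indicator_of_notMem hy]
      have h0 : f (c⁻¹ • (y - z)) = 0 := by
        by_contra h
        refine hy ?_
        have := hsub _ (subset_tsupport _ h)
        rwa [smul_inv_smul₀ hc.ne', add_sub_cancel] at this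
      simp [indicator, h0]
  have hap0 : a * p ≠ 0 := mul_ne_zero ha0 hp0
  have hapT : a * p ≠ ⊤ := ENNReal.mul_ne_top haT ENNReal.ofReal_ne_top
  rw [← ENNReal.mul_le_mul_iff_right hap0 hapT, mul_left_comm, mul_left_comm _ (1 / 2)]
  exact (mul_le_mul_right hleft _).trans (htest.trans (mul_le_mul_right hright _))

theorem le_kappa_of_hardyInequality [NeZero n] (hα1 : 1 < α) (hα2 : α < 2) (hΩ : IsOpen Ω)
    (hc : Convex ℝ Ω) (hne : Ω.Nonempty) (hb : (frontier Ω).Nonempty)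
    (hH : HardyInequality 𝕜 α Ω (weightd α Ω) C) : C ≤ kappa n α := by
  have hα0 : 0 < α := by linarith
  have ⟨x, hx⟩ := hne
  obtain ⟨z, hz⟩ := exists_mem_closestBdryPoints hb x
  have hzΩ : z ∉ Ω := fun h ↦ hz.1.2 (by rwa [hΩ.interior_eq])
  obtain ⟨ν, hν⟩ := exists_mem_supportingNormals hΩ hc hne hzΩ
  have hhalf := hH.halfSpace hΩ hα0 hx hz hν
  rw [kappa_eq_mul_sphereConst hα0, mul_comm]
  refine le_mul_kappa_one hα1 hα2 (half_pos (sphereConst_pos hα0)).le fun g hg hgc hgs hE ↦ ?_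
  exact mul_lintegral_le_energy hα0 hα2 hν.1 hhalf hg hgc hgs hE

end Sharpness

end FracHardy

end

theorem mainTheorem1 (𝕜 : Type*) [RCLike 𝕜] (n : ℕ) [NeZero n] (α : ℝ) (hα1 : 1 < α) (hα2 : α < 2)
    (Ω : Set (FracHardy.E n)) (hΩo : IsOpen Ω) (hΩc : IsConnected Ω)
    (hΩb : (frontier Ω).Nonempty) :
    FracHardy.HardyInequality 𝕜 α Ω (FracHardy.weightM α Ω) (FracHardy.kappa n α) ∧
    (Convex ℝ Ω →
      FracHardy.HardyInequality 𝕜 α Ω (FracHardy.weightD α Ω) (FracHardy.kappa n α) ∧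
      FracHardy.HardyInequality 𝕜 α Ω (FracHardy.weightd α Ω) (FracHardy.kappa n α) ∧
      (∀ C : ℝ, FracHardy.HardyInequality 𝕜 α Ω (FracHardy.weightM α Ω) C →
        C ≤ FracHardy.kappa n α) ∧
      (∀ C : ℝ, FracHardy.HardyInequality 𝕜 α Ω (FracHardy.weightD α Ω) C →
        C ≤ FracHardy.kappa n α) ∧
      (∀ C : ℝ, FracHardy.HardyInequality 𝕜 α Ω (FracHardy.weightd α Ω) C →
        C ≤ FracHardy.kappa n α)) := by
  have hα : 0 < α := by linarith
  have h1 : FracHardy.HardyInequality 𝕜 α Ω (FracHardy.weightM α Ω) (FracHardy.kappa n α) :=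
    FracHardy.hardyInequality_weightM hα1 hα2 hΩo
  refine ⟨h1, fun hconv ↦ ?_⟩
  have hdD : ∀ x ∈ Ω, FracHardy.weightd α Ω x ≤ FracHardy.weightD α Ω x :=
    fun x _ ↦ FracHardy.weightd_le_weightD hα x
  have hDM : ∀ x ∈ Ω, FracHardy.weightD α Ω x ≤ FracHardy.weightM α Ω x :=
    fun x hx ↦ FracHardy.weightD_le_weightM hα hΩo hconv hΩb hx
  have hsharp : ∀ C : ℝ, FracHardy.HardyInequality 𝕜 α Ω (FracHardy.weightd α Ω) C →
      C ≤ FracHardy.kappa n α := fun C hC ↦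
    FracHardy.le_kappa_of_hardyInequality hα1 hα2 hΩo hconv hΩc.nonempty hΩb hC
  have h2 := h1.mono hΩo.measurableSet hDM
  exact ⟨h2, h2.mono hΩo.measurableSet hdD,
    fun C hC ↦ hsharp C ((hC.mono hΩo.measurableSet hDM).mono hΩo.measurableSet hdD),
    fun C hC ↦ hsharp C (hC.mono hΩo.measurableSet hdD), hsharp⟩
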